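/- Let $N$ be a smooth manifold of dimension $n=n^++n^-$. Let $p_F\colon F(N)\to N$ be the bundle of linear frames, $p_M\colon M\to N$ the bundle of pseudo-Riemannian metrics of signature $(n^+,n^-)$, $p_C\colon C\to N$ the bundle of linear connections (whose fibre at $x$ consists of the splittings at $x$ of the Atiyah sequence of $F(N)$, i.e. of the right-invariant horizontal lifts $X\mapsto X_u^{h_{\Gamma_x}}\in T_uF(N)$, $X\in T_xN$, $u\in F_x(N)$), and $p\colon M\times_NC\to N$ the fibred product. Let $q\colon F(N)\to M$ be the map sending a linear frame $u=(X_1,\dots,X_n)$ with dual coframe $(w^1,\dots,w^n)$ to the metric $\sum_h\varepsilon_h\,w^h\otimes w^h$, where $\varepsilon_h=1$ for $h\le n^+$ and $\varepsilon_h=-1$ for $h>n^+$. A coordinate system $(x^i)$ on an open set $U\subseteq N$ induces the coordinates $(x^i,y_{jk})$, $y_{jk}(g_x)=g_x(\partial/\partial x^j,\partial/\partial x^k)$, on $p_M^{-1}(U)$; the coordinates $(x^i,x^i_j)$ on $p_F^{-1}(U)$, with $X_j=x^i_j(u)\,(\partial/\partial x^i)_x$; and the coordinates $(x^i,A^i_{jk})$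 on $p_C^{-1}(U)$, determined by $$(\partial/\partial x^j)_u^{h_{\Gamma_x}}=\partial/\partial x^j-A^i_{jk}(\Gamma_x)\,x^k_l(u)\,\partial/\partial x^i_l .$$ An Ehresmann connection on $M\times_NC$ is a smooth $1$-form $\gamma$ on $M\times_NC$ with values in the vertical bundle $V(p)$ such that $\gamma(X)=X$ for all $X\in V(p)$; locally $$\gamma=\sum_{i\le j}(dy_{ij}+\gamma_{ijk}\,dx^k)\otimes\frac{\partial}{\partial y_{ij}}+(dA^i_{jk}+\gamma^i_{jkl}\,dx^l)\otimes\frac{\partial}{\partial A^i_{jk}},$$ and one sets $\gamma_{jik}=\gamma_{ijk}$. Let $\gamma_M$ be the unique homomorphism, from the pull-back of $TM$ to the pull-back of $V(p_M)$ to $M\times_NC$, such that $(\mathrm{pr}_1)_*\gamma(X)=\gamma_M((\mathrm{pr}_1)_*X)$ for all $X\in T(M\times_NC)$, where $\mathrm{pr}_1\colon M\times_NC\to M$ is the projection. For all $x\in N$, $g_x\in p_M^{-1}(x)$, $\Gamma_x\in p_C^{-1}(x)$ and $X\in T_xN$, the vector $q_*(X_u^{h_{\Gamma_x}})\in T_{g_x}M$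 does not depend on the linear frame $u\in q^{-1}(g_x)$. Moreover, an Ehresmann connection $\gamma$ on $M\times_NC$ satisfies the condition $(C_M)$: $\ \gamma_M\bigl((g_x,\Gamma_x),X\bigr)=X-q_*\Bigl(\bigl((p_M)_*X\bigr)_u^{h_{\Gamma_x}}\Bigr)$ for all $(g_x,\Gamma_x)\in M\times_NC$, all $X\in T_{g_x}M$ and all $u\in q^{-1}(g_x)$, if and only if in every coordinate system, for all $k,l,j$, $$\gamma_{klj}=-\sum_a\bigl(y_{al}A^a_{jk}+y_{ak}A^a_{jl}\bigr).$$ -/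

import Mathlib

noncomputable section

open Set Filter Topology
open scoped Manifold ContDiff

namespace MetConn

/-- The model space `ℝⁿ`. -/
abbrev Rn (n : ℕ) : Type := EuclideanSpace ℝ (Fin n)

/-- The `j`-th vector of the standard basis of `ℝⁿ`. -/
def stdVec (n : ℕ) (j : Fin n) : Rn n := EuclideanSpace.single j 1

section Base

variable (n : ℕ) (N : Type*) [TopologicalSpace N] [ChartedSpace (Rn n) N]

/-- The coordinate systems of the smooth manifold `N`: the charts of its maximal smooth atlas. -/
abbrev CoordSys : Set (OpenPartialHomeomorph N (Rn n)) := IsManifold.maximalAtlas (𝓡 n) ∞ N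

/-- Fibre coordinates on a set `P` lying over the smooth manifold `N`: every coordinate system `φ`
of `N` on `U` induces a bijection `p ↦ (φ (proj p), coord φ p)` of `proj ⁻¹ U` onto
`φ(U) × range`, where `range` is an open set of a normed space `V`, and the changes of coordinates
are smooth. -/
structure FibreCoords (P : Type*) (V : Type*) [NormedAddCommGroup V] [NormedSpace ℝ V] where
  proj : P → N
  coord : OpenPartialHomeomorph N (Rn n) → P → V
  range : Set V
  isOpen_range : IsOpen range
  nonempty_range : range.Nonempty
  coord_mem : ∀ φ ∈ CoordSys n N, ∀ p, proj p ∈ φ.source → coord φ p ∈ range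
  exists_coord : ∀ φ ∈ CoordSys n N, ∀ x ∈ φ.source, ∀ v ∈ range, ∃ p, proj p = x ∧ coord φ p = v
  coord_inj : ∀ φ ∈ CoordSys n N, ∀ p p', proj p ∈ φ.source → proj p = proj p' →
    coord φ p = coord φ p' → p = p'
  exists_trans : ∀ φ ∈ CoordSys n N, ∀ ψ ∈ CoordSys n N, ∃ T : Rn n × V → V,
    ContDiffOn ℝ ∞ T ((φ.symm ≫ₕ ψ).source ×ˢ range) ∧
    ∀ p, proj p ∈ φ.source → proj p ∈ ψ.source → coord ψ p = T (φ (proj p), coord φ p)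

end Base

namespace FibreCoords

variable {n : ℕ} {N : Type*} [TopologicalSpace N] [ChartedSpace (Rn n) N]
  {P : Type*} {V : Type*} [NormedAddCommGroup V] [NormedSpace ℝ V]
  (D : FibreCoords n N P V)

open Classical in
/-- The point of `P` with given coordinates (arbitrary outside of the range of the coordinates). -/
def inv (φ : OpenPartialHomeomorph N (Rn n)) [Nonempty P] (z : Rn n × V) : P :=
  if h : ∃ p, D.proj p = φ.symm z.1 ∧ D.coord φ p = z.2 then h.choose else Classical.arbitrary P

theorem nonempty_total (D : FibreCoords n N P V) [Nonempty N] [IsManifold (𝓡 n) ∞ N] : Nonempty P := by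
  obtain ⟨x⟩ := ‹Nonempty N›
  obtain ⟨v, hv⟩ := D.nonempty_range
  obtain ⟨p, -⟩ := D.exists_coord (chartAt (Rn n) x) (IsManifold.chart_mem_maximalAtlas x) x
    (mem_chart_source _ x) v hv
  exact ⟨p⟩

theorem nonempty_of_chart (D : FibreCoords n N P V) [IsManifold (𝓡 n) ∞ N] (φ : OpenPartialHomeomorph N (Rn n)) :
    Nonempty P := by
  have : Nonempty N := ⟨φ.symm 0⟩
  exact D.nonempty_total

/-- The coordinate system `(x, v)` on `P` induced by a coordinate system of `N`. -/
def chart [IsManifold (𝓡 n) ∞ N] (φ : OpenPartialHomeomorph N (Rn n))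
    (hφ : φ ∈ CoordSys n N) : PartialEquiv P (Rn n × V) :=
  haveI : Nonempty P := D.nonempty_of_chart φ
  have key : ∀ z ∈ φ.target ×ˢ D.range,
      D.proj (D.inv φ z) = φ.symm z.1 ∧ D.coord φ (D.inv φ z) = z.2 := by
    intro z hz
    have h := D.exists_coord φ hφ (φ.symm z.1) (φ.map_target hz.1) z.2 hz.2
    unfold inv
    rw [dif_pos h]
    exact h.choose_spec
  { toFun := fun p => (φ (D.proj p), D.coord φ p)
    invFun := D.inv φ
    source := D.proj ⁻¹' φ.source
    target := φ.target ×ˢ D.range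
    map_source' := fun p hp => ⟨φ.map_source hp, D.coord_mem φ hφ p hp⟩
    map_target' := fun z hz => by
      change D.proj (D.inv φ z) ∈ φ.source
      rw [(key z hz).1]
      exact φ.map_target hz.1
    left_inv' := fun p hp => by
      have hz : (φ (D.proj p), D.coord φ p) ∈ φ.target ×ˢ D.range :=
        ⟨φ.map_source hp, D.coord_mem φ hφ p hp⟩
      have hp1 : D.proj (D.inv φ (φ (D.proj p), D.coord φ p)) = D.proj p := by
        rw [(key _ hz).1]
        exact φ.left_inv hp
      exact D.coord_inj φ hφ _ _ (by rw [hp1]; exact hp) hp1 (key _ hz).2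
    right_inv' := fun z hz => by
      rw [(key z hz).1, (key z hz).2, φ.right_inv hz.1] }

variable [IsManifold (𝓡 n) ∞ N]

theorem chart_trans_source (φ ψ : OpenPartialHomeomorph N (Rn n)) (hφ : φ ∈ CoordSys n N)
    (hψ : ψ ∈ CoordSys n N) :
    ((D.chart φ hφ).symm.trans (D.chart ψ hψ)).source = (φ.symm ≫ₕ ψ).source ×ˢ D.range := by
  ext z
  have h1 : ∀ z ∈ φ.target ×ˢ D.range, D.proj ((D.chart φ hφ).symm z) = φ.symm z.1 := by
    intro z hz
    have h2 := (D.chart φ hφ).map_target hz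
    have h3 := congrArg Prod.fst ((D.chart φ hφ).right_inv hz)
    change φ (D.proj ((D.chart φ hφ).symm z)) = z.1 at h3
    rw [← h3]
    exact (φ.left_inv h2).symm
  rw [PartialEquiv.trans_source]
  constructor
  · rintro ⟨hz, hz'⟩
    refine ⟨?_, hz.2⟩
    rw [OpenPartialHomeomorph.trans_source]
    refine ⟨hz.1, ?_⟩
    change D.proj ((D.chart φ hφ).symm z) ∈ ψ.source at hz'
    rw [h1 z hz] at hz'
    exact hz'
  · rintro ⟨hz, hz'⟩
    rw [OpenPartialHomeomorph.trans_source] at hz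
    have hz2 : z ∈ φ.target ×ˢ D.range := ⟨hz.1, hz'⟩
    refine ⟨hz2, ?_⟩
    change D.proj ((D.chart φ hφ).symm z) ∈ ψ.source
    rw [h1 z hz2]
    exact hz.2

theorem chart_trans_contDiffOn (φ ψ : OpenPartialHomeomorph N (Rn n)) (hφ : φ ∈ CoordSys n N)
    (hψ : ψ ∈ CoordSys n N) :
    ContDiffOn ℝ ∞ ((D.chart φ hφ).symm.trans (D.chart ψ hψ))
      ((D.chart φ hφ).symm.trans (D.chart ψ hψ)).source := by
  obtain ⟨T, hT, hT'⟩ := D.exists_trans φ hφ ψ hψ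
  have h0 : ContDiffOn ℝ ∞ (φ.symm ≫ₕ ψ) (φ.symm ≫ₕ ψ).source := by
    have := IsManifold.compatible_of_mem_maximalAtlas hφ hψ
    rw [contDiffGroupoid, mem_groupoid_of_pregroupoid] at this
    simpa [contDiffPregroupoid] using this.1
  have h1 : ContDiffOn ℝ ∞ (fun z : Rn n × V => ((φ.symm ≫ₕ ψ) z.1, T z))
      ((φ.symm ≫ₕ ψ).source ×ˢ D.range) :=
    (h0.comp contDiff_fst.contDiffOn (fun z hz => hz.1)).prodMk hT
  rw [D.chart_trans_source φ ψ hφ hψ]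
  refine h1.congr ?_
  intro z hz
  have hz0 := hz
  rw [← D.chart_trans_source φ ψ hφ hψ, PartialEquiv.trans_source] at hz0
  have h3 := (D.chart φ hφ).right_inv hz0.1
  have h2 := (D.chart φ hφ).map_target hz0.1
  have h4 : (φ (D.proj ((D.chart φ hφ).symm z)), D.coord φ ((D.chart φ hφ).symm z)) = z := h3
  have h5 : D.proj ((D.chart φ hφ).symm z) = φ.symm z.1 := by
    rw [← congrArg Prod.fst h4]
    exact (φ.left_inv h2).symm
  change (ψ (D.proj ((D.chart φ hφ).symm z)), D.coord ψ ((D.chart φ hφ).symm z)) = _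
  rw [hT' _ h2 hz0.2, h4, h5]
  rfl

/-- The atlas of the induced coordinate systems. -/
def core : ChartedSpaceCore (Rn n × V) P where
  atlas := {e | ∃ φ, ∃ hφ : φ ∈ CoordSys n N, e = D.chart φ hφ}
  chartAt := fun p => D.chart (chartAt (Rn n) (D.proj p)) (IsManifold.chart_mem_maximalAtlas _)
  mem_chart_source := fun p => mem_chart_source (Rn n) (D.proj p)
  chart_mem_atlas := fun p => ⟨_, IsManifold.chart_mem_maximalAtlas _, rfl⟩
  open_source := by
    rintro _ _ ⟨φ, hφ, rfl⟩ ⟨ψ, hψ, rfl⟩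
    rw [D.chart_trans_source φ ψ hφ hψ]
    exact (φ.symm ≫ₕ ψ).open_source.prod D.isOpen_range
  continuousOn_toFun := by
    rintro _ _ ⟨φ, hφ, rfl⟩ ⟨ψ, hψ, rfl⟩
    exact (D.chart_trans_contDiffOn φ ψ hφ hψ).continuousOn

/-- The manifold topology of `P`. -/
abbrev topology : TopologicalSpace P := D.core.toTopologicalSpace

/-- The manifold structure of `P`, whose atlas consists of the induced coordinate systems. -/
abbrev chartedSpace : @ChartedSpace (Rn n × V) _ P D.topology := D.core.toChartedSpace

/-- The induced coordinate system as a homeomorphism between open sets. -/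
abbrev homeo (φ : OpenPartialHomeomorph N (Rn n)) (hφ : φ ∈ CoordSys n N) :
    @OpenPartialHomeomorph P (Rn n × V) D.topology _ :=
  D.core.openPartialHomeomorph (D.chart φ hφ) ⟨φ, hφ, rfl⟩

theorem homeo_mem_atlas (φ : OpenPartialHomeomorph N (Rn n)) (hφ : φ ∈ CoordSys n N) :
    D.homeo φ hφ ∈ @atlas (Rn n × V) _ P D.topology D.chartedSpace := by
  change D.homeo φ hφ ∈ ⋃ (e : PartialEquiv P (Rn n × V)) (he : e ∈ D.core.atlas),
    {D.core.openPartialHomeomorph e he}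
  simp only [mem_iUnion, mem_singleton_iff]
  exact ⟨_, ⟨φ, hφ, rfl⟩, rfl⟩

theorem isManifold :
    @IsManifold ℝ _ (Rn n × V) _ _ _ _ 𝓘(ℝ, Rn n × V) ∞ P D.topology D.chartedSpace := by
  let _ := D.topology
  let _ := D.chartedSpace
  refine isManifold_of_contDiffOn _ _ _ ?_
  intro e e' he he'
  change e ∈ ⋃ (e : PartialEquiv P (Rn n × V)) (he : e ∈ D.core.atlas),
    {D.core.openPartialHomeomorph e he} at he
  change e' ∈ ⋃ (e : PartialEquiv P (Rn n × V)) (he : e ∈ D.core.atlas),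
    {D.core.openPartialHomeomorph e he} at he'
  simp only [mem_iUnion, mem_singleton_iff] at he he'
  obtain ⟨_, ⟨φ, hφ, rfl⟩, rfl⟩ := he
  obtain ⟨_, ⟨ψ, hψ, rfl⟩, rfl⟩ := he'
  have := D.chart_trans_contDiffOn φ ψ hφ hψ
  simp only [modelWithCornersSelf_coe, modelWithCornersSelf_coe_symm, preimage_id, range_id,
    inter_univ, Function.comp_id, Function.id_comp]
  exact this

end FibreCoords

section Frames

variable {n : ℕ} {N : Type*} [TopologicalSpace N] [ChartedSpace (Rn n) N]

theorem mdifferentiable_coordSys {φ : OpenPartialHomeomorph N (Rn n)} (hφ : φ ∈ CoordSys n N) :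
    φ.MDifferentiable (𝓡 n) (𝓡 n) :=
  ⟨(contMDiffOn_of_mem_maximalAtlas hφ).mdifferentiableOn (by simp),
    (contMDiffOn_symm_of_mem_maximalAtlas hφ).mdifferentiableOn (by simp)⟩

theorem contDiffOn_trans {φ ψ : OpenPartialHomeomorph N (Rn n)} (hφ : φ ∈ CoordSys n N)
    (hψ : ψ ∈ CoordSys n N) : ContDiffOn ℝ ∞ (φ.symm ≫ₕ ψ) (φ.symm ≫ₕ ψ).source := by
  have := IsManifold.compatible_of_mem_maximalAtlas hφ hψ
  rw [contDiffGroupoid, mem_groupoid_of_pregroupoid] at this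
  simpa [contDiffPregroupoid] using this.1

theorem contDiffOn_fderiv_trans {φ ψ : OpenPartialHomeomorph N (Rn n)} (hφ : φ ∈ CoordSys n N)
    (hψ : ψ ∈ CoordSys n N) :
    ContDiffOn ℝ ∞ (fderiv ℝ (φ.symm ≫ₕ ψ)) (φ.symm ≫ₕ ψ).source :=
  (contDiffOn_trans hφ hψ).fderiv_of_isOpen (φ.symm ≫ₕ ψ).open_source (by simp)

theorem mem_trans_source {N : Type*} [TopologicalSpace N] {φ ψ : OpenPartialHomeomorph N (Rn n)}
    {x : N} (hx : x ∈ φ.source) (hx' : x ∈ ψ.source) : φ x ∈ (φ.symm ≫ₕ ψ).source := by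
  rw [OpenPartialHomeomorph.trans_source]
  refine ⟨φ.map_source hx, ?_⟩
  change φ.symm (φ x) ∈ ψ.source
  rwa [φ.left_inv hx]

/-- The inverse of the differential of a coordinate system at a point of its domain. -/
def coordIso {φ : OpenPartialHomeomorph N (Rn n)} (hφ : φ ∈ CoordSys n N) {x : N}
    (hx : x ∈ φ.source) : Rn n ≃L[ℝ] TangentSpace (𝓡 n) x :=
  ((mdifferentiable_coordSys hφ).mfderiv hx).symm

open Classical in
/-- The coordinate frame `(∂/∂x¹, …, ∂/∂xⁿ)` of a coordinate system `φ` at a point `x` of its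
domain, as the linear isomorphism `ℝⁿ → T_x N` inverse to the differential of `φ`
(with an arbitrary value if `x` is not in the domain). -/
def coordFrame (φ : OpenPartialHomeomorph N (Rn n)) (x : N) :
    Rn n ≃L[ℝ] TangentSpace (𝓡 n) x :=
  if h : φ ∈ CoordSys n N ∧ x ∈ φ.source then coordIso h.1 h.2 else ContinuousLinearEquiv.refl ℝ (Rn n)

theorem coordFrame_eq {φ : OpenPartialHomeomorph N (Rn n)} (hφ : φ ∈ CoordSys n N) {x : N}
    (hx : x ∈ φ.source) : coordFrame φ x = coordIso hφ hx :=
  dif_pos ⟨hφ, hx⟩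

theorem coordFrame_symm_apply {φ : OpenPartialHomeomorph N (Rn n)} (hφ : φ ∈ CoordSys n N) {x : N}
    (hx : x ∈ φ.source) (v : TangentSpace (𝓡 n) x) :
    (coordFrame φ x).symm v = mfderiv (𝓡 n) (𝓡 n) φ x v := by
  rw [coordFrame_eq hφ hx]
  rfl

theorem coordFrame_apply {φ : OpenPartialHomeomorph N (Rn n)} (hφ : φ ∈ CoordSys n N) {x : N}
    (hx : x ∈ φ.source) (v : Rn n) :
    coordFrame φ x v = mfderiv (𝓡 n) (𝓡 n) φ.symm (φ x) v := by
  rw [coordFrame_eq hφ hx]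
  rfl

/-- The differential of the change of coordinates relates the two coordinate frames. -/
theorem coordFrame_trans {φ ψ : OpenPartialHomeomorph N (Rn n)} (hφ : φ ∈ CoordSys n N)
    (hψ : ψ ∈ CoordSys n N) {x : N} (hx : x ∈ φ.source) (hx' : x ∈ ψ.source) (v : Rn n) :
    (coordFrame ψ x).symm (coordFrame φ x v) = fderiv ℝ (φ.symm ≫ₕ ψ) (φ x) v := by
  rw [coordFrame_symm_apply hψ hx', coordFrame_apply hφ hx, ← mfderiv_eq_fderiv]
  have h1 := (mdifferentiable_coordSys hφ).mdifferentiableAt_symm (φ.map_source hx)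
  have h2 : MDifferentiableAt (𝓡 n) (𝓡 n) ψ (φ.symm (φ x)) := by
    rw [φ.left_inv hx]
    exact (mdifferentiable_coordSys hψ).mdifferentiableAt hx'
  have h3 := mfderiv_comp (φ x) h2 h1
  rw [OpenPartialHomeomorph.coe_trans, h3, φ.left_inv hx]
  rfl

end Frames

section FrameBundle

/-- The linear frame bundle `F(N)`. A linear frame `(X₁, …, Xₙ)` at a point is given as the linear
isomorphism of `ℝⁿ` onto the tangent space that sends the standard basis to `(X₁, …, Xₙ)`. -/
@[ext] structure FrameBundle (n : ℕ) (N : Type*) [TopologicalSpace N] [ChartedSpace (Rn n) N] where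
  pt : N
  iso : Rn n ≃L[ℝ] TangentSpace (𝓡 n) pt

variable (n : ℕ) (N : Type*) [TopologicalSpace N] [ChartedSpace (Rn n) N]

/-- The coordinates `(xⁱ_j)` on the frame bundle, as a linear map: its matrix has the coordinates
of `X_j` with respect to `(∂/∂x¹, …, ∂/∂xⁿ)` as its `j`-th column. -/
def FrameBundle.coord {n : ℕ} {N : Type*} [TopologicalSpace N] [ChartedSpace (Rn n) N]
    (φ : OpenPartialHomeomorph N (Rn n)) (u : FrameBundle n N) :
    Rn n →L[ℝ] Rn n :=
  (u.iso.trans (coordFrame φ u.pt).symm : Rn n ≃L[ℝ] Rn n)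

/-- The coordinate systems of the frame bundle. -/
def frameCoords : FibreCoords n N (FrameBundle n N) (Rn n →L[ℝ] Rn n) where
  proj := FrameBundle.pt
  coord := FrameBundle.coord
  range := {L | IsUnit L}
  isOpen_range := Units.isOpen
  nonempty_range := ⟨1, isUnit_one⟩
  coord_mem := fun φ _ u _ =>
    ⟨ContinuousLinearEquiv.toUnit (u.iso.trans (coordFrame φ u.pt).symm), rfl⟩
  exists_coord := by
    rintro φ - x - _ ⟨L, rfl⟩
    refine ⟨⟨x, (ContinuousLinearEquiv.ofUnit L).trans (coordFrame φ x)⟩, rfl, ?_⟩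
    ext1 v
    exact (coordFrame φ x).symm_apply_apply _
  coord_inj := by
    rintro φ - ⟨x, u⟩ ⟨x', u'⟩ - h h'
    change x = x' at h
    subst h
    congr 1
    refine ContinuousLinearEquiv.ext (funext fun v => ?_)
    have := congrArg (fun L : Rn n →L[ℝ] Rn n => L v) h'
    exact (coordFrame φ x).symm.injective this
  exists_trans := by
    intro φ hφ ψ hψ
    refine ⟨fun z => (fderiv ℝ (φ.symm ≫ₕ ψ) z.1).comp z.2, ?_, ?_⟩
    · exact ((contDiffOn_fderiv_trans hφ hψ).comp contDiff_fst.contDiffOn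
        (fun z hz => hz.1)).clm_comp contDiff_snd.contDiffOn
    · intro u hu hu'
      ext1 v
      change _ = fderiv ℝ (φ.symm ≫ₕ ψ) (φ u.pt) ((coordFrame φ u.pt).symm (u.iso v))
      rw [← coordFrame_trans hφ hψ hu hu', ContinuousLinearEquiv.apply_symm_apply]
      rfl

variable [IsManifold (𝓡 n) ∞ N]

instance FrameBundle.topology : TopologicalSpace (FrameBundle n N) := (frameCoords n N).topology

instance FrameBundle.chartedSpace : ChartedSpace (Rn n × (Rn n →L[ℝ] Rn n)) (FrameBundle n N) :=
  (frameCoords n N).chartedSpace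

instance FrameBundle.isManifold :
    IsManifold 𝓘(ℝ, Rn n × (Rn n →L[ℝ] Rn n)) ∞ (FrameBundle n N) :=
  (frameCoords n N).isManifold

end FrameBundle

section SymmetricMatrices

variable (n : ℕ)

/-- The space of symmetric matrices `(y_jk)`. -/
def SymMat : Submodule ℝ (Fin n → Fin n → ℝ) where
  carrier := {y | ∀ j k, y j k = y k j}
  add_mem' := by
    intro A B hA hB j k
    simp [hA j k, hB j k]
  zero_mem' := by simp
  smul_mem' := by
    intro c B hB j k
    simp [hB j k]

/-- The sign `ε_h`: it is `1` for the first `r` indices and `-1` for the other ones. -/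
def eps {n : ℕ} (r : ℕ) (h : Fin n) : ℝ := if (h : ℕ) < r then 1 else -1

theorem eps_mul_self {n : ℕ} (r : ℕ) (h : Fin n) : eps r h * eps r h = 1 := by
  unfold eps
  split_ifs <;> norm_num

theorem stdVec_apply (i j : Fin n) : stdVec n i j = if j = i then 1 else 0 := by
  simp [stdVec, PiLp.single_apply]

theorem sum_stdVec (v : Rn n) : ∑ i, v i • stdVec n i = v := by
  ext j
  simp [stdVec_apply]

/-- The symmetrization of a matrix. -/
def symmetrize : (Fin n → Fin n → ℝ) →L[ℝ] SymMat n :=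
  LinearMap.toContinuousLinearMap
    { toFun := fun B => ⟨fun j k => 2⁻¹ * (B j k + B k j), by
        intro j k
        simp [add_comm]⟩
      map_add' := by
        intro A B
        ext j k
        simp
        ring
      map_smul' := by
        intro c B
        ext j k
        simp
        ring }

theorem symmetrize_apply (B : Fin n → Fin n → ℝ) (j k : Fin n) :
    (symmetrize n B).1 j k = 2⁻¹ * (B j k + B k j) := rfl

theorem symmetrize_of_mem (B : SymMat n) : symmetrize n B.1 = B := by
  ext j k
  rw [symmetrize_apply, B.2 j k]
  ring

/-- The symmetrization of the matrix `(∑_h ε_h K^h_j H^h_k)`. -/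
def epsBilin (r : ℕ) : (Rn n →L[ℝ] Rn n) →L[ℝ] (Rn n →L[ℝ] Rn n) →L[ℝ] SymMat n :=
  LinearMap.toContinuousBilinearMap
    (LinearMap.mk₂ ℝ (fun K H => symmetrize n
        (fun j k => ∑ h, eps r h * (K (stdVec n j) h * H (stdVec n k) h)))
      (by
        intro K K' H
        rw [← map_add]
        congr 1
        ext j k
        simp [← Finset.sum_add_distrib, add_mul, mul_add])
      (by
        intro c K H
        rw [← map_smul]
        congr 1
        ext j k
        simp [Finset.mul_sum, mul_left_comm, mul_assoc])
      (by
        intro K H H'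
        rw [← map_add]
        congr 1
        ext j k
        simp [← Finset.sum_add_distrib, mul_add])
      (by
        intro c K H
        rw [← map_smul]
        congr 1
        ext j k
        simp [Finset.mul_sum, mul_left_comm]))

theorem epsBilin_apply (r : ℕ) (K H : Rn n →L[ℝ] Rn n) (j k : Fin n) :
    (epsBilin n r K H).1 j k =
      2⁻¹ * ((∑ h, eps r h * (K (stdVec n j) h * H (stdVec n k) h)) +
        ∑ h, eps r h * (K (stdVec n k) h * H (stdVec n j) h)) := rfl

theorem epsBilin_self_apply (r : ℕ) (K : Rn n →L[ℝ] Rn n) (j k : Fin n) :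
    (epsBilin n r K K).1 j k = ∑ h, eps r h * (K (stdVec n j) h * K (stdVec n k) h) := by
  have : ∀ h, K (stdVec n k) h * K (stdVec n j) h = K (stdVec n j) h * K (stdVec n k) h :=
    fun h => mul_comm _ _
  rw [epsBilin_apply]
  simp only [this]
  ring

/-- The matrices of the bilinear forms of signature `(r, n - r)` on `ℝⁿ`. -/
def sigSet (r : ℕ) : Set (SymMat n) :=
  {y | ∃ K : Rn n →L[ℝ] Rn n, IsUnit K ∧
    ∀ j k, y.1 j k = ∑ h, eps r h * (K (stdVec n j) h * K (stdVec n k) h)}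

theorem mem_sigSet_iff (r : ℕ) (y : SymMat n) :
    y ∈ sigSet n r ↔ ∃ K : Rn n →L[ℝ] Rn n, IsUnit K ∧ epsBilin n r K K = y := by
  refine exists_congr fun K => and_congr_right fun _ => ?_
  constructor
  · intro h
    ext j k
    rw [epsBilin_self_apply, h]
  · rintro rfl j k
    rw [epsBilin_self_apply]

theorem isOpen_sigSet (r : ℕ) : IsOpen (sigSet n r) := by
  rw [isOpen_iff_mem_nhds]
  intro B hB
  obtain ⟨_, ⟨K, rfl⟩, rfl⟩ := (mem_sigSet_iff n r B).1 hB
  have hf := (epsBilin n r).hasStrictFDerivAt_of_bilinear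
    (hasStrictFDerivAt_id (𝕜 := ℝ) (K : Rn n →L[ℝ] Rn n))
    (hasStrictFDerivAt_id (𝕜 := ℝ) (K : Rn n →L[ℝ] Rn n))
  have hs : map (fun K => epsBilin n r K K) (𝓝 (K : Rn n →L[ℝ] Rn n)) =
      𝓝 (epsBilin n r K K) := hf.map_nhds_eq_of_surj (by
    rw [LinearMap.range_eq_top]
    intro S
    let L := ContinuousLinearEquiv.ofUnit K
    let b : Rn n →ₗ[ℝ] Rn n →ₗ[ℝ] ℝ := LinearMap.mk₂ ℝ
      (fun v w => ∑ i, ∑ j, S.1 i j * (v i * w j))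
      (by intro v v' w; simp [← Finset.sum_add_distrib, mul_add, add_mul])
      (by intro c v w; simp [Finset.mul_sum, mul_left_comm, mul_assoc])
      (by intro v w w'; simp [← Finset.sum_add_distrib, mul_add])
      (by intro c v w; simp [Finset.mul_sum, mul_left_comm])
    have hb : ∀ j k, b (stdVec n j) (stdVec n k) = S.1 j k := by
      intro j k
      simp [b, stdVec_apply]
    let H : Rn n →ₗ[ℝ] Rn n := (2⁻¹ : ℝ) • ∑ h, eps r h •
      (b (L.symm (stdVec n h))).smulRight (stdVec n h)
    have hH : ∀ w h, H w h = 2⁻¹ * (eps r h * b (L.symm (stdVec n h)) w) := by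
      intro w h
      simp [H, stdVec_apply]
    have hS : ∀ v w, ∑ h, L v h * b (L.symm (stdVec n h)) w = b v w := by
      intro v w
      conv_rhs => rw [← L.symm_apply_apply v, ← sum_stdVec n (L v)]
      simp
    have hE : ∀ v w, ∑ h, eps r h * (L v h * H w h) = 2⁻¹ * b v w := by
      intro v w
      rw [← hS v w, Finset.mul_sum]
      refine Finset.sum_congr rfl fun h _ => ?_
      rw [hH]
      linear_combination (2⁻¹ * (L v h * b (L.symm (stdVec n h)) w)) * eps_mul_self r h
    have hE' : ∀ v w, ∑ h, eps r h * (H w h * L v h) = 2⁻¹ * b v w := by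
      intro v w
      rw [← hE]
      exact Finset.sum_congr rfl fun h _ => by ring
    refine ⟨LinearMap.toContinuousLinearMap H, ?_⟩
    ext j k
    change (epsBilin n r K (LinearMap.toContinuousLinearMap H)).1 j k +
      (epsBilin n r (LinearMap.toContinuousLinearMap H) K).1 j k = S.1 j k
    rw [epsBilin_apply, epsBilin_apply]
    change 2⁻¹ * (∑ h, eps r h * (L (stdVec n j) h * H (stdVec n k) h) +
      ∑ h, eps r h * (L (stdVec n k) h * H (stdVec n j) h)) +
      2⁻¹ * (∑ h, eps r h * (H (stdVec n j) h * L (stdVec n k) h) +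
      ∑ h, eps r h * (H (stdVec n k) h * L (stdVec n j) h)) = S.1 j k
    rw [hE, hE, hE', hE', hb, hb, S.2 k j]
    ring)
  have hU : {L : Rn n →L[ℝ] Rn n | IsUnit L} ∈ 𝓝 (K : Rn n →L[ℝ] Rn n) :=
    Units.isOpen.mem_nhds K.isUnit
  have := image_mem_map (m := fun K => epsBilin n r K K) hU
  rw [hs] at this
  refine mem_of_superset this ?_
  rintro _ ⟨L, hL, rfl⟩
  exact (mem_sigSet_iff n r _).2 ⟨L, hL, rfl⟩

theorem nonempty_sigSet (r : ℕ) : (sigSet n r).Nonempty :=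
  ⟨_, (mem_sigSet_iff n r _).2 ⟨1, isUnit_one, rfl⟩⟩

theorem contDiff_symMat {X : Type*} [NormedAddCommGroup X] [NormedSpace ℝ X] {s : Set X}
    {y : X → SymMat n} (h : ∀ j k, ContDiffOn ℝ ∞ (fun x => (y x).1 j k) s) :
    ContDiffOn ℝ ∞ y s := by
  have h2 : ContDiffOn ℝ ∞ (fun x => (y x).1) s :=
    contDiffOn_pi.2 fun j => contDiffOn_pi.2 fun k => h j k
  refine ((symmetrize n).contDiff.comp_contDiffOn h2).congr fun x _ => ?_
  exact (symmetrize_of_mem n (y x)).symm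

end SymmetricMatrices

section Metrics

/-- A metric of signature `(nplus, nminus)` at a point `x` of a manifold of dimension
`n = nplus + nminus`: a symmetric bilinear form on the tangent space that has an orthonormal frame
whose first `nplus` vectors have square `1` and whose other `nminus` vectors have square `-1`. -/
@[ext] structure MetricAt (n : ℕ) {N : Type*} [TopologicalSpace N] [ChartedSpace (Rn n) N]
    (nplus : ℕ) (x : N) where
  form : TangentSpace (𝓡 n) x →ₗ[ℝ] TangentSpace (𝓡 n) x →ₗ[ℝ] ℝ
  symm : ∀ v w, form v w = form w v
  exists_frame : ∃ u : Rn n ≃L[ℝ] TangentSpace (𝓡 n) x, ∀ i j,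
    form (u (stdVec n i)) (u (stdVec n j)) = if i = j then eps nplus i else 0

/-- The bundle `M` of metrics of signature `(nplus, nminus)`. -/
@[ext] structure MetBundle (n : ℕ) (N : Type*) [TopologicalSpace N] [ChartedSpace (Rn n) N]
    (nplus : ℕ) where
  pt : N
  val : MetricAt n nplus pt

variable {n : ℕ} {N : Type*} [TopologicalSpace N] [ChartedSpace (Rn n) N]

/-- The metric `q(u) = ∑_h ε_h w^h ⊗ w^h` at `x`, where `(w¹, …, wⁿ)` is the dual coframe of the
linear frame `u` at `x`. -/
def frameMetric (nplus : ℕ) {x : N} (u : Rn n ≃L[ℝ] TangentSpace (𝓡 n) x) : MetricAt n nplus x where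
  form := LinearMap.mk₂ ℝ (fun v w => ∑ h, eps nplus h * (u.symm v h * u.symm w h))
    (by intro v v' w; simp [← Finset.sum_add_distrib, mul_add, add_mul])
    (by intro c v w; simp [Finset.mul_sum, mul_left_comm, mul_assoc])
    (by intro v w w'; simp [← Finset.sum_add_distrib, mul_add])
    (by intro c v w; simp [Finset.mul_sum, mul_left_comm])
  symm := by
    intro v w
    change ∑ h, eps nplus h * (u.symm v h * u.symm w h) =
      ∑ h, eps nplus h * (u.symm w h * u.symm v h)
    exact Finset.sum_congr rfl fun h _ => by ring
  exists_frame := by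
    refine ⟨u, fun i j => ?_⟩
    change ∑ h, eps nplus h * (u.symm (u (stdVec n i)) h * u.symm (u (stdVec n j)) h) = _
    by_cases hij : i = j
    · simp [stdVec_apply, hij]
    · simp [stdVec_apply, hij, Ne.symm hij]

theorem frameMetric_apply (nplus : ℕ) {x : N} (u : Rn n ≃L[ℝ] TangentSpace (𝓡 n) x)
    (v w : TangentSpace (𝓡 n) x) :
    (frameMetric nplus u).form v w = ∑ h, eps nplus h * (u.symm v h * u.symm w h) := rfl

theorem form_ext {x : N} (u : Rn n ≃L[ℝ] TangentSpace (𝓡 n) x)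
    {a b : TangentSpace (𝓡 n) x →ₗ[ℝ] TangentSpace (𝓡 n) x →ₗ[ℝ] ℝ}
    (h : ∀ i j, a (u (stdVec n i)) (u (stdVec n j)) = b (u (stdVec n i)) (u (stdVec n j))) :
    a = b := by
  ext v w
  have hv : ∑ i, u.symm v i • u (stdVec n i) = v := by
    have := congrArg u (sum_stdVec n (u.symm v))
    simpa only [map_sum, map_smul, u.apply_symm_apply] using this
  have hw : ∑ i, u.symm w i • u (stdVec n i) = w := by
    have := congrArg u (sum_stdVec n (u.symm w))
    simpa only [map_sum, map_smul, u.apply_symm_apply] using this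
  rw [← hv, ← hw]
  simp [h]

theorem exists_frameMetric_eq {nplus : ℕ} {x : N} (g : MetricAt n nplus x) :
    ∃ u : Rn n ≃L[ℝ] TangentSpace (𝓡 n) x, frameMetric nplus u = g := by
  obtain ⟨u, hu⟩ := g.exists_frame
  refine ⟨u, MetricAt.ext (form_ext u fun i j => ?_)⟩
  rw [hu, frameMetric_apply]
  by_cases hij : i = j
  · simp [stdVec_apply, hij]
  · simp [stdVec_apply, hij, Ne.symm hij]

/-- The coordinates `y_jk(g) = g(∂/∂x^j, ∂/∂x^k)` on the bundle of metrics. -/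
def MetBundle.coord {nplus : ℕ} (φ : OpenPartialHomeomorph N (Rn n)) (g : MetBundle n N nplus) :
    SymMat n :=
  ⟨fun j k => g.val.form (coordFrame φ g.pt (stdVec n j)) (coordFrame φ g.pt (stdVec n k)),
    fun _ _ => g.val.symm _ _⟩

variable (n N)

/-- The coordinate systems `(xⁱ, y_jk)` of the bundle of metrics. -/
def metricCoords (nplus : ℕ) : FibreCoords n N (MetBundle n N nplus) (SymMat n) where
  proj := MetBundle.pt
  coord := MetBundle.coord
  range := sigSet n nplus
  isOpen_range := isOpen_sigSet n nplus
  nonempty_range := nonempty_sigSet n nplus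
  coord_mem := by
    rintro φ - ⟨x, g⟩ -
    obtain ⟨u, rfl⟩ := exists_frameMetric_eq g
    exact ⟨_, ⟨ContinuousLinearEquiv.toUnit ((coordFrame φ x).trans u.symm), rfl⟩, fun j k => rfl⟩
  exists_coord := by
    rintro φ - x - y ⟨_, ⟨K, rfl⟩, hK⟩
    refine ⟨⟨x, frameMetric nplus ((ContinuousLinearEquiv.ofUnit K).symm.trans (coordFrame φ x))⟩,
      rfl, ?_⟩
    ext j k
    rw [hK]
    have : ∀ v, ((ContinuousLinearEquiv.ofUnit K).symm.trans (coordFrame φ x)).symm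
        (coordFrame φ x v) = (K : Rn n →L[ℝ] Rn n) v := by
      intro v
      change ContinuousLinearEquiv.ofUnit K ((coordFrame φ x).symm (coordFrame φ x v)) = _
      rw [ContinuousLinearEquiv.symm_apply_apply]
      rfl
    change ∑ h, eps nplus h * (((ContinuousLinearEquiv.ofUnit K).symm.trans
      (coordFrame φ x)).symm (coordFrame φ x (stdVec n j)) h *
      ((ContinuousLinearEquiv.ofUnit K).symm.trans
      (coordFrame φ x)).symm (coordFrame φ x (stdVec n k)) h) = _
    rw [this, this]
  coord_inj := by
    rintro φ - ⟨x, g⟩ ⟨x', g'⟩ - h h'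
    change x = x' at h
    subst h
    congr 1
    refine MetricAt.ext (form_ext (coordFrame φ x) fun j k => ?_)
    exact congrArg (fun y : SymMat n => y.1 j k) h'
  exists_trans := by
    intro φ hφ ψ hψ
    let M : Rn n → (Rn n →L[ℝ] Rn n) := fun a => fderiv ℝ (ψ.symm ≫ₕ φ) ((φ.symm ≫ₕ ψ) a)
    have hM : ContDiffOn ℝ ∞ M (φ.symm ≫ₕ ψ).source := by
      refine (contDiffOn_fderiv_trans hψ hφ).comp (contDiffOn_trans hφ hψ) ?_
      intro a ha
      exact (φ.symm ≫ₕ ψ).map_source ha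
    refine ⟨fun z => ⟨fun j k => ∑ a, ∑ b, z.2.1 a b *
      (M z.1 (stdVec n j) a * M z.1 (stdVec n k) b), ?_⟩, ?_, ?_⟩
    · intro j k
      refine Finset.sum_comm.trans ?_
      refine Finset.sum_congr rfl fun a _ => Finset.sum_congr rfl fun b _ => ?_
      rw [z.2.2 b a]
      ring
    · refine contDiff_symMat n fun j k => ?_
      have h1 : ∀ j a, ContDiffOn ℝ ∞ (fun z : Rn n × SymMat n => M z.1 (stdVec n j) a)
          ((φ.symm ≫ₕ ψ).source ×ˢ sigSet n nplus) := by
        intro j a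
        exact (EuclideanSpace.proj (𝕜 := ℝ) a).contDiff.comp_contDiffOn
          ((hM.comp contDiff_fst.contDiffOn fun z hz => hz.1).clm_apply contDiffOn_const)
      have h2 : ∀ a b, ContDiff ℝ ∞ (fun z : Rn n × SymMat n => z.2.1 a b) := by
        intro a b
        exact contDiff_apply_apply ℝ ℝ a b |>.comp
          ((SymMat n).subtypeL.contDiff.comp contDiff_snd)
      have h3 : ContDiffOn ℝ ∞ (fun z : Rn n × SymMat n => ∑ a, ∑ b, z.2.1 a b *
          (M z.1 (stdVec n j) a * M z.1 (stdVec n k) b))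
          ((φ.symm ≫ₕ ψ).source ×ˢ sigSet n nplus) :=
        ContDiffOn.sum fun a _ => ContDiffOn.sum fun b _ =>
          (h2 a b).contDiffOn.mul ((h1 j a).mul (h1 k b))
      exact h3
    · rintro ⟨x, g⟩ hx hx'
      have hT : ∀ v, coordFrame ψ x v = coordFrame φ x (M (φ x) v) := by
        intro v
        have h3 : (φ.symm ≫ₕ ψ) (φ x) = ψ x := congrArg ψ (φ.left_inv hx)
        change _ = coordFrame φ x (fderiv ℝ (ψ.symm ≫ₕ φ) ((φ.symm ≫ₕ ψ) (φ x)) v)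
        rw [h3, ← coordFrame_trans hψ hφ hx' hx, ContinuousLinearEquiv.apply_symm_apply]
      ext j k
      change g.form (coordFrame ψ x (stdVec n j)) (coordFrame ψ x (stdVec n k)) =
        ∑ a, ∑ b, g.form (coordFrame φ x (stdVec n a)) (coordFrame φ x (stdVec n b)) *
          (M (φ x) (stdVec n j) a * M (φ x) (stdVec n k) b)
      rw [hT, hT]
      conv_lhs => rw [← sum_stdVec n (M (φ x) (stdVec n j)), ← sum_stdVec n (M (φ x) (stdVec n k))]
      simp only [map_sum, map_smul, LinearMap.sum_apply, LinearMap.smul_apply, smul_eq_mul]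
      rw [Finset.sum_comm]
      refine Finset.sum_congr rfl fun a _ => ?_
      simp only [Finset.mul_sum]
      refine Finset.sum_congr rfl fun b _ => ?_
      ring

variable [IsManifold (𝓡 n) ∞ N] (nplus : ℕ)

instance MetBundle.topology : TopologicalSpace (MetBundle n N nplus) := (metricCoords n N nplus).topology

instance MetBundle.chartedSpace : ChartedSpace (Rn n × SymMat n) (MetBundle n N nplus) :=
  (metricCoords n N nplus).chartedSpace

instance MetBundle.isManifold : IsManifold 𝓘(ℝ, Rn n × SymMat n) ∞ (MetBundle n N nplus) :=
  (metricCoords n N nplus).isManifold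

end Metrics

section Differentials

variable {W W' P P' : Type*} [NormedAddCommGroup W] [NormedSpace ℝ W]
  [NormedAddCommGroup W'] [NormedSpace ℝ W'] [TopologicalSpace P] [ChartedSpace W P]
  [TopologicalSpace P'] [ChartedSpace W' P']

theorem mdifferentiable_of_mem_maximalAtlas {Φ : OpenPartialHomeomorph P W}
    (hΦ : Φ ∈ IsManifold.maximalAtlas 𝓘(ℝ, W) ∞ P) :
    Φ.MDifferentiable 𝓘(ℝ, W) 𝓘(ℝ, W) :=
  ⟨(contMDiffOn_of_mem_maximalAtlas hΦ).mdifferentiableOn (by simp),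
    (contMDiffOn_symm_of_mem_maximalAtlas hΦ).mdifferentiableOn (by simp)⟩

/-- The differential of a map given in coordinates by `F`. -/
theorem mfderiv_in_coord {Φ : OpenPartialHomeomorph P W} {Φ' : OpenPartialHomeomorph P' W'}
    (hΦ : Φ ∈ IsManifold.maximalAtlas 𝓘(ℝ, W) ∞ P)
    (hΦ' : Φ' ∈ IsManifold.maximalAtlas 𝓘(ℝ, W') ∞ P') {f : P → P'} {F : W → W'} {p : P}
    (hp : p ∈ Φ.source) (hf : ∀ p' ∈ Φ.source, f p' ∈ Φ'.source)
    (hF : ∀ p' ∈ Φ.source, Φ' (f p') = F (Φ p')) (hd : DifferentiableAt ℝ F (Φ p)) :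
    MDifferentiableAt 𝓘(ℝ, W) 𝓘(ℝ, W') f p ∧ ∀ v : TangentSpace 𝓘(ℝ, W) p,
      mfderiv 𝓘(ℝ, W') 𝓘(ℝ, W') Φ' (f p) (mfderiv 𝓘(ℝ, W) 𝓘(ℝ, W') f p v) =
        fderiv ℝ F (Φ p) (mfderiv 𝓘(ℝ, W) 𝓘(ℝ, W) Φ p v) := by
  have h1 := (mdifferentiable_of_mem_maximalAtlas hΦ).mdifferentiableAt hp
  have h2 := (mdifferentiable_of_mem_maximalAtlas hΦ').mdifferentiableAt (hf p hp)
  have h3 := (mdifferentiable_of_mem_maximalAtlas hΦ').mdifferentiableAt_symm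
    (Φ'.map_source (hf p hp))
  have hd' : MDifferentiableAt 𝓘(ℝ, W) 𝓘(ℝ, W') F (Φ p) := hd.mdifferentiableAt
  have hFΦ := hd'.comp p h1
  have hev : ∀ᶠ p' in 𝓝 p, p' ∈ Φ.source := Φ.open_source.mem_nhds hp
  have hmd : MDifferentiableAt 𝓘(ℝ, W) 𝓘(ℝ, W') f p := by
    have h3' : MDifferentiableAt 𝓘(ℝ, W') 𝓘(ℝ, W') Φ'.symm ((F ∘ Φ) p) := by
      change MDifferentiableAt 𝓘(ℝ, W') 𝓘(ℝ, W') Φ'.symm (F (Φ p))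
      rw [← hF p hp]
      exact h3
    refine (h3'.comp p hFΦ).congr_of_eventuallyEq ?_
    filter_upwards [hev] with p' hp'
    change f p' = Φ'.symm (F (Φ p'))
    rw [← hF p' hp', Φ'.left_inv (hf p' hp')]
  refine ⟨hmd, fun v => ?_⟩
  have hc : mfderiv 𝓘(ℝ, W) 𝓘(ℝ, W') (Φ' ∘ f) p = mfderiv 𝓘(ℝ, W) 𝓘(ℝ, W') (F ∘ Φ) p := by
    refine Filter.EventuallyEq.mfderiv_eq ?_
    filter_upwards [hev] with p' hp'
    exact hF p' hp'
  rw [mfderiv_comp p h2 hmd, mfderiv_comp p hd' h1, mfderiv_eq_fderiv] at hc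
  exact congrArg (fun L : W →L[ℝ] W' => L v) hc

/-- The differential of a vector-valued function given in coordinates by `F`. -/
theorem mfderiv_fun_in_coord {Φ : OpenPartialHomeomorph P W}
    (hΦ : Φ ∈ IsManifold.maximalAtlas 𝓘(ℝ, W) ∞ P) {f : P → W'} {F : W → W'} {p : P}
    (hp : p ∈ Φ.source) (hF : ∀ p' ∈ Φ.source, f p' = F (Φ p'))
    (hd : DifferentiableAt ℝ F (Φ p)) :
    MDifferentiableAt 𝓘(ℝ, W) 𝓘(ℝ, W') f p ∧ ∀ v : TangentSpace 𝓘(ℝ, W) p,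
      mfderiv 𝓘(ℝ, W) 𝓘(ℝ, W') f p v =
        fderiv ℝ F (Φ p) (mfderiv 𝓘(ℝ, W) 𝓘(ℝ, W) Φ p v) := by
  have h1 := (mdifferentiable_of_mem_maximalAtlas hΦ).mdifferentiableAt hp
  have hd' : MDifferentiableAt 𝓘(ℝ, W) 𝓘(ℝ, W') F (Φ p) := hd.mdifferentiableAt
  have hFΦ := hd'.comp p h1
  have hev : f =ᶠ[𝓝 p] F ∘ Φ := by
    filter_upwards [Φ.open_source.mem_nhds hp] with p' hp'
    exact hF p' hp'
  refine ⟨hFΦ.congr_of_eventuallyEq hev, fun v => ?_⟩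
  have hc := hev.mfderiv_eq (I := 𝓘(ℝ, W)) (I' := 𝓘(ℝ, W'))
  rw [mfderiv_comp p hd' h1, mfderiv_eq_fderiv] at hc
  exact congrArg (fun L : W →L[ℝ] W' => L v) hc

end Differentials

section FrameDifferentials

variable {n : ℕ} {N : Type*} [TopologicalSpace N] [ChartedSpace (Rn n) N]
  [IsManifold (𝓡 n) ∞ N]

/-- The right translation `u ↦ u · A` of the frame bundle. -/
def rightMul (A : Rn n ≃L[ℝ] Rn n) (u : FrameBundle n N) : FrameBundle n N :=
  ⟨u.pt, A.trans u.iso⟩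

/-- The model with corners of the frame bundle. -/
abbrev frameI (n : ℕ) := 𝓘(ℝ, Rn n × (Rn n →L[ℝ] Rn n))

/-- The coordinate system `(xⁱ, xⁱ_j)` of the frame bundle. -/
def frameChart {φ : OpenPartialHomeomorph N (Rn n)} (hφ : φ ∈ CoordSys n N) :
    OpenPartialHomeomorph (FrameBundle n N) (Rn n × (Rn n →L[ℝ] Rn n)) :=
  (frameCoords n N).homeo φ hφ

theorem frameChart_mem {φ : OpenPartialHomeomorph N (Rn n)} (hφ : φ ∈ CoordSys n N) :
    frameChart hφ ∈ IsManifold.maximalAtlas (frameI n) ∞ (FrameBundle n N) :=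
  IsManifold.subset_maximalAtlas ((frameCoords n N).homeo_mem_atlas φ hφ)

/-- The differentials of the coordinates `(xⁱ, xⁱ_j)` of the frame bundle. -/
def frameVel {φ : OpenPartialHomeomorph N (Rn n)} (hφ : φ ∈ CoordSys n N) (u : FrameBundle n N) :
    TangentSpace (frameI n) u →L[ℝ] Rn n × (Rn n →L[ℝ] Rn n) :=
  mfderiv (frameI n) (frameI n) (frameChart hφ) u

/-- The differentials of the coordinates `(xⁱ_j)` of the frame bundle. -/
def dFrameCoord (φ : OpenPartialHomeomorph N (Rn n)) (u : FrameBundle n N) :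
    TangentSpace (frameI n) u →L[ℝ] (Rn n →L[ℝ] Rn n) :=
  mfderiv (frameI n) 𝓘(ℝ, Rn n →L[ℝ] Rn n) (FrameBundle.coord φ) u

theorem frameVel_fst {φ : OpenPartialHomeomorph N (Rn n)} (hφ : φ ∈ CoordSys n N)
    (u : FrameBundle n N) (hu : u.pt ∈ φ.source) (w : TangentSpace (frameI n) u) :
    (frameVel hφ u w).1 =
      (coordFrame φ u.pt).symm (mfderiv (frameI n) (𝓡 n) FrameBundle.pt u w) := by
  have := (mfderiv_in_coord (frameChart_mem hφ) hφ (f := FrameBundle.pt) (F := Prod.fst) (p := u)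
    hu (fun p' hp' => hp') (fun p' hp' => rfl) differentiableAt_fst).2 w
  rw [fderiv_fst] at this
  rw [coordFrame_symm_apply hφ hu]
  exact this.symm

theorem frameVel_snd {φ : OpenPartialHomeomorph N (Rn n)} (hφ : φ ∈ CoordSys n N)
    (u : FrameBundle n N) (hu : u.pt ∈ φ.source) (w : TangentSpace (frameI n) u) :
    (frameVel hφ u w).2 = dFrameCoord φ u w := by
  have := (mfderiv_fun_in_coord (frameChart_mem hφ) (f := FrameBundle.coord φ) (F := Prod.snd)
    (p := u) hu (fun p' hp' => rfl) differentiableAt_snd).2 w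
  rw [fderiv_snd] at this
  exact this.symm

theorem frameVel_rightMul {φ : OpenPartialHomeomorph N (Rn n)} (hφ : φ ∈ CoordSys n N)
    (A : Rn n ≃L[ℝ] Rn n) (u : FrameBundle n N) (hu : u.pt ∈ φ.source)
    (w : TangentSpace (frameI n) u) :
    frameVel hφ (rightMul A u) (mfderiv (frameI n) (frameI n) (rightMul A) u w) =
      ((frameVel hφ u w).1, (frameVel hφ u w).2.comp (A : Rn n →L[ℝ] Rn n)) := by
  let F : Rn n × (Rn n →L[ℝ] Rn n) →L[ℝ] Rn n × (Rn n →L[ℝ] Rn n) :=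
    (ContinuousLinearMap.fst ℝ _ _).prod
      (((ContinuousLinearMap.compL ℝ (Rn n) (Rn n) (Rn n)).flip (A : Rn n →L[ℝ] Rn n)).comp
        (ContinuousLinearMap.snd ℝ _ _))
  have := (mfderiv_in_coord (frameChart_mem hφ) (frameChart_mem hφ) (f := rightMul A) (F := F)
    (p := u) hu (fun p' hp' => hp') (fun p' hp' => rfl) F.differentiableAt).2 w
  rw [F.fderiv] at this
  exact this

theorem frameVel_bijective {φ : OpenPartialHomeomorph N (Rn n)} (hφ : φ ∈ CoordSys n N)
    (u : FrameBundle n N) (hu : u.pt ∈ φ.source) : Function.Bijective (frameVel hφ u) :=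
  (mdifferentiable_of_mem_maximalAtlas (frameChart_mem hφ)).mfderiv_bijective hu

/-- The differential of the frame coordinates is an isomorphism. -/
def frameVelIso {φ : OpenPartialHomeomorph N (Rn n)} (hφ : φ ∈ CoordSys n N)
    (u : FrameBundle n N) (hu : u.pt ∈ φ.source) :
    TangentSpace (frameI n) u ≃L[ℝ] Rn n × (Rn n →L[ℝ] Rn n) :=
  (mdifferentiable_of_mem_maximalAtlas (frameChart_mem hφ)).mfderiv hu

theorem frameVelIso_apply {φ : OpenPartialHomeomorph N (Rn n)} (hφ : φ ∈ CoordSys n N)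
    (u : FrameBundle n N) (hu : u.pt ∈ φ.source) (w : TangentSpace (frameI n) u) :
    frameVelIso hφ u hu w = frameVel hφ u w := rfl

/-- The effect of a change of coordinates on the differentials of the frame coordinates. -/
theorem dFrameCoord_trans {φ ψ : OpenPartialHomeomorph N (Rn n)} (hφ : φ ∈ CoordSys n N)
    (hψ : ψ ∈ CoordSys n N) (u : FrameBundle n N) (hu : u.pt ∈ φ.source) (hu' : u.pt ∈ ψ.source)
    (w : TangentSpace (frameI n) u) :
    dFrameCoord ψ u w =
      (fderiv ℝ (fderiv ℝ (φ.symm ≫ₕ ψ)) (φ u.pt) (frameVel hφ u w).1).comp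
        (FrameBundle.coord φ u) +
      (fderiv ℝ (φ.symm ≫ₕ ψ) (φ u.pt)).comp (frameVel hφ u w).2 := by
  let F : Rn n × (Rn n →L[ℝ] Rn n) → (Rn n →L[ℝ] Rn n) :=
    fun z => (fderiv ℝ (φ.symm ≫ₕ ψ) z.1).comp z.2
  have hmem : φ u.pt ∈ (φ.symm ≫ₕ ψ).source := mem_trans_source hu hu'
  have hd : DifferentiableAt ℝ (fderiv ℝ (φ.symm ≫ₕ ψ)) (φ u.pt) :=
    ((contDiffOn_fderiv_trans hφ hψ).differentiableOn (by simp)).differentiableAt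
      ((φ.symm ≫ₕ ψ).open_source.mem_nhds hmem)
  have hF : HasFDerivAt F _ (frameChart hφ u) :=
    HasFDerivAt.clm_comp
      (c := fun z : Rn n × (Rn n →L[ℝ] Rn n) => fderiv ℝ (φ.symm ≫ₕ ψ) z.1)
      (d := Prod.snd) (x := frameChart hφ u)
      (hd.hasFDerivAt.comp (frameChart hφ u) hasFDerivAt_fst) hasFDerivAt_snd
  have hev : FrameBundle.coord ψ =ᶠ[𝓝 u] F ∘ frameChart hφ := by
    have h1 : (frameChart hφ).source ∩ (frameChart hψ).source ∈ 𝓝 u :=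
      Filter.inter_mem ((frameChart hφ).open_source.mem_nhds hu)
        ((frameChart hψ).open_source.mem_nhds hu')
    filter_upwards [h1] with u1 hu1
    ext1 v
    have hu2 : u1.pt ∈ φ.source := hu1.1
    have hu3 : u1.pt ∈ ψ.source := hu1.2
    change _ = fderiv ℝ (φ.symm ≫ₕ ψ) (φ u1.pt) ((coordFrame φ u1.pt).symm (u1.iso v))
    rw [← coordFrame_trans hφ hψ hu2 hu3, ContinuousLinearEquiv.apply_symm_apply]
    rfl
  have h1 := (mdifferentiable_of_mem_maximalAtlas (frameChart_mem hφ)).mdifferentiableAt hu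
  have hc := hev.mfderiv_eq (I := frameI n) (I' := 𝓘(ℝ, Rn n →L[ℝ] Rn n))
  rw [mfderiv_comp u hF.differentiableAt.mdifferentiableAt h1, mfderiv_eq_fderiv, hF.fderiv] at hc
  refine (congrArg (fun L : (Rn n × (Rn n →L[ℝ] Rn n)) →L[ℝ] (Rn n →L[ℝ] Rn n) => L w) hc).trans ?_
  exact add_comm _ _

end FrameDifferentials

section Connections

theorem coord_coordFrame {n : ℕ} {N : Type*} [TopologicalSpace N] [ChartedSpace (Rn n) N]
    (φ : OpenPartialHomeomorph N (Rn n)) (x : N) :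
    FrameBundle.coord φ ⟨x, coordFrame φ x⟩ = ContinuousLinearMap.id ℝ (Rn n) := by
  ext1 v
  exact (coordFrame φ x).symm_apply_apply v

/-- A linear connection at a point `x`, i.e. an element of the fibre `C_x` of the bundle of linear
connections: a splitting `T_x N → (T F(N) / GL(n, ℝ))_x` of the Atiyah sequence at `x`. It is given
by the horizontal lifts `X ↦ X_u^h ∈ T_u F(N)` of the tangent vectors `X` at `x` to the linear
frames `u` at `x`, which are invariant under the right translations of the frame bundle. -/
@[ext] structure ConnAt (n : ℕ) {N : Type*} [TopologicalSpace N] [ChartedSpace (Rn n) N]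
    [IsManifold (𝓡 n) ∞ N] (x : N) where
  lift : ∀ u : Rn n ≃L[ℝ] TangentSpace (𝓡 n) x,
    TangentSpace (𝓡 n) x →L[ℝ] TangentSpace (frameI n) (⟨x, u⟩ : FrameBundle n N)
  proj_lift : ∀ u X, mfderiv (frameI n) (𝓡 n) FrameBundle.pt (⟨x, u⟩ : FrameBundle n N)
    (lift u X) = X
  lift_rightMul : ∀ (A : Rn n ≃L[ℝ] Rn n) u X, lift (A.trans u) X =
    mfderiv (frameI n) (frameI n) (rightMul A) (⟨x, u⟩ : FrameBundle n N) (lift u X)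

/-- The bundle `C` of linear connections. -/
@[ext] structure ConnBundle (n : ℕ) (N : Type*) [TopologicalSpace N] [ChartedSpace (Rn n) N]
    [IsManifold (𝓡 n) ∞ N] where
  pt : N
  val : ConnAt n pt

variable {n : ℕ} {N : Type*} [TopologicalSpace N] [ChartedSpace (Rn n) N]
  [IsManifold (𝓡 n) ∞ N]

/-- The space of arrays `(A^i_jk)`, where `A^i_jk` is the `i`-th component of
`A(e_j)(e_k)`. -/
abbrev Christoffel (n : ℕ) : Type := Rn n →L[ℝ] Rn n →L[ℝ] Rn n

/-- The Christoffel symbols `A^i_jk` of a linear connection at `x` in the coordinate system `φ`.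
They are determined by the formula `(∂/∂x^j)^h = ∂/∂x^j - A^i_jk x^k_l ∂/∂x^i_l`, taken at
the coordinate frame `(∂/∂x¹, …, ∂/∂xⁿ)`, where `x^k_l = δ^k_l`. -/
def ConnAt.coord {x : N} (φ : OpenPartialHomeomorph N (Rn n)) (Γ : ConnAt n x) : Christoffel n :=
  -((dFrameCoord φ ⟨x, coordFrame φ x⟩).comp
    ((Γ.lift (coordFrame φ x)).comp
      (coordFrame φ x : Rn n →L[ℝ] TangentSpace (𝓡 n) x)))

/-- The local expression of the horizontal lift at an arbitrary frame. -/
theorem frameVel_lift {φ : OpenPartialHomeomorph N (Rn n)} (hφ : φ ∈ CoordSys n N) {x : N}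
    (hx : x ∈ φ.source) (Γ : ConnAt n x) (u : Rn n ≃L[ℝ] TangentSpace (𝓡 n) x)
    (X : TangentSpace (𝓡 n) x) :
    frameVel hφ ⟨x, u⟩ (Γ.lift u X) = ((coordFrame φ x).symm X,
      -((Γ.coord φ ((coordFrame φ x).symm X)).comp (FrameBundle.coord φ ⟨x, u⟩))) := by
  let A : Rn n ≃L[ℝ] Rn n := u.trans (coordFrame φ x).symm
  have hA : A.trans (coordFrame φ x) = u := by
    refine ContinuousLinearEquiv.ext (funext fun v => ?_)
    exact (coordFrame φ x).apply_symm_apply _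
  have h1 : ∀ u, (frameVel hφ ⟨x, u⟩ (Γ.lift u X)).1 = (coordFrame φ x).symm X := by
    intro u
    have h2 := frameVel_fst hφ ⟨x, u⟩ hx (Γ.lift u X)
    rw [Γ.proj_lift u X] at h2
    exact h2
  refine Prod.ext (h1 u) ?_
  have h3 : (frameVel hφ ⟨x, A.trans (coordFrame φ x)⟩
      (Γ.lift (A.trans (coordFrame φ x)) X)).2 =
      (frameVel hφ ⟨x, coordFrame φ x⟩ (Γ.lift (coordFrame φ x) X)).2.comp
        (A : Rn n →L[ℝ] Rn n) := by
    rw [Γ.lift_rightMul]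
    exact congrArg Prod.snd (frameVel_rightMul hφ A ⟨x, coordFrame φ x⟩ hx _)
  rw [hA] at h3
  rw [h3, frameVel_snd hφ _ hx]
  ext1 v
  change _ = -(-(dFrameCoord φ ⟨x, coordFrame φ x⟩ (Γ.lift (coordFrame φ x)
    (coordFrame φ x ((coordFrame φ x).symm X))))) (A v)
  rw [ContinuousLinearEquiv.apply_symm_apply]
  exact (neg_neg (dFrameCoord φ ⟨x, coordFrame φ x⟩ (Γ.lift (coordFrame φ x) X) (A v))).symm

theorem ConnAt.coord_injective {φ : OpenPartialHomeomorph N (Rn n)} (hφ : φ ∈ CoordSys n N) {x : N}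
    (hx : x ∈ φ.source) : Function.Injective (ConnAt.coord (x := x) φ) := by
  intro Γ Γ' h
  refine ConnAt.ext (funext fun u => ?_)
  ext1 X
  apply (frameVel_bijective hφ ⟨x, u⟩ hx).1
  rw [frameVel_lift hφ hx, frameVel_lift hφ hx, h]

/-- Composition on the right, as a continuous linear map. -/
abbrev rightComp (K : Rn n →L[ℝ] Rn n) : (Rn n →L[ℝ] Rn n) →L[ℝ] (Rn n →L[ℝ] Rn n) :=
  (ContinuousLinearMap.compL ℝ (Rn n) (Rn n) (Rn n)).flip K

/-- Composition on the left, as a continuous linear map. -/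
abbrev leftComp (K : Rn n →L[ℝ] Rn n) : (Rn n →L[ℝ] Rn n) →L[ℝ] (Rn n →L[ℝ] Rn n) :=
  ContinuousLinearMap.compL ℝ (Rn n) (Rn n) (Rn n) K

theorem contDiff_rightComp : ContDiff ℝ ∞ (rightComp (n := n)) :=
  ContinuousLinearMap.contDiff (𝕜 := ℝ) (E := Rn n →L[ℝ] Rn n)
    (F := (Rn n →L[ℝ] Rn n) →L[ℝ] (Rn n →L[ℝ] Rn n))
    (ContinuousLinearMap.compL ℝ (Rn n) (Rn n) (Rn n)).flip

theorem contDiff_leftComp : ContDiff ℝ ∞ (leftComp (n := n)) :=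
  ContinuousLinearMap.contDiff (𝕜 := ℝ) (E := Rn n →L[ℝ] Rn n)
    (F := (Rn n →L[ℝ] Rn n) →L[ℝ] (Rn n →L[ℝ] Rn n))
    (ContinuousLinearMap.compL ℝ (Rn n) (Rn n) (Rn n))

/-- The horizontal lift with given Christoffel symbols. -/
def liftOf {φ : OpenPartialHomeomorph N (Rn n)} (hφ : φ ∈ CoordSys n N) {x : N}
    (hx : x ∈ φ.source) (A : Christoffel n) (u : Rn n ≃L[ℝ] TangentSpace (𝓡 n) x) :
    TangentSpace (𝓡 n) x →L[ℝ] TangentSpace (frameI n) (⟨x, u⟩ : FrameBundle n N) :=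
  ((frameVelIso hφ ⟨x, u⟩ hx).symm :
      (Rn n × (Rn n →L[ℝ] Rn n)) →L[ℝ] TangentSpace (frameI n) (⟨x, u⟩ : FrameBundle n N)).comp
    ((((ContinuousLinearMap.id ℝ (Rn n)).prod
      (-((rightComp (FrameBundle.coord φ ⟨x, u⟩)).comp A)))).comp
      ((coordFrame φ x).symm : TangentSpace (𝓡 n) x →L[ℝ] Rn n))

theorem frameVel_liftOf {φ : OpenPartialHomeomorph N (Rn n)} (hφ : φ ∈ CoordSys n N) {x : N}
    (hx : x ∈ φ.source) (A : Christoffel n) (u : Rn n ≃L[ℝ] TangentSpace (𝓡 n) x)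
    (X : TangentSpace (𝓡 n) x) :
    frameVel hφ ⟨x, u⟩ (liftOf hφ hx A u X) = ((coordFrame φ x).symm X,
      -((A ((coordFrame φ x).symm X)).comp (FrameBundle.coord φ ⟨x, u⟩))) :=
  (frameVelIso hφ ⟨x, u⟩ hx).apply_symm_apply _

theorem ConnAt.exists_coord {φ : OpenPartialHomeomorph N (Rn n)} (hφ : φ ∈ CoordSys n N) {x : N}
    (hx : x ∈ φ.source) (A : Christoffel n) : ∃ Γ : ConnAt n x, Γ.coord φ = A := by
  refine ⟨⟨liftOf hφ hx A, fun u X => ?_, fun B u X => ?_⟩, ?_⟩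
  · apply (coordFrame φ x).symm.injective
    have := frameVel_fst hφ ⟨x, u⟩ hx (liftOf hφ hx A u X)
    rw [frameVel_liftOf] at this
    exact this.symm
  · apply (frameVel_bijective hφ ⟨x, B.trans u⟩ hx).1
    have := frameVel_rightMul hφ B ⟨x, u⟩ hx (liftOf hφ hx A u X)
    rw [frameVel_liftOf] at this
    rw [frameVel_liftOf]
    refine Eq.trans ?_ this.symm
    rfl
  · ext1 v
    change -(dFrameCoord φ ⟨x, coordFrame φ x⟩ (liftOf hφ hx A (coordFrame φ x)
      (coordFrame φ x v))) = A v
    rw [← frameVel_snd hφ _ hx, frameVel_liftOf, coord_coordFrame,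
      ContinuousLinearEquiv.symm_apply_apply, neg_neg]
    rfl

/-- The transformation law of the Christoffel symbols. -/
theorem ConnAt.coord_trans {φ ψ : OpenPartialHomeomorph N (Rn n)} (hφ : φ ∈ CoordSys n N)
    (hψ : ψ ∈ CoordSys n N) {x : N} (hx : x ∈ φ.source) (hx' : x ∈ ψ.source) (Γ : ConnAt n x)
    {K : Rn n →L[ℝ] Rn n} (hK : ∀ v, coordFrame ψ x v = coordFrame φ x (K v)) :
    Γ.coord ψ = (rightComp K).comp
      ((leftComp (fderiv ℝ (φ.symm ≫ₕ ψ) (φ x))).comp ((Γ.coord φ).comp K)) -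
      (rightComp K).comp ((fderiv ℝ (fderiv ℝ (φ.symm ≫ₕ ψ)) (φ x)).comp K) := by
  ext1 v
  have h1 := dFrameCoord_trans hφ hψ ⟨x, coordFrame ψ x⟩ hx hx'
    (Γ.lift (coordFrame ψ x) (coordFrame ψ x v))
  have h2 : FrameBundle.coord φ ⟨x, coordFrame ψ x⟩ = K := by
    ext1 w
    change (coordFrame φ x).symm (coordFrame ψ x w) = K w
    rw [hK, ContinuousLinearEquiv.symm_apply_apply]
  have h3 : (coordFrame φ x).symm (coordFrame ψ x v) = K v := by
    rw [hK, ContinuousLinearEquiv.symm_apply_apply]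
  rw [frameVel_lift hφ hx, h2, h3] at h1
  change -(dFrameCoord ψ ⟨x, coordFrame ψ x⟩ (Γ.lift (coordFrame ψ x) (coordFrame ψ x v))) = _
  rw [h1]
  ext1 w
  simp
  abel

variable (n N)

/-- The coordinate systems `(xⁱ, A^i_jk)` of the bundle of linear connections. -/
def connCoords : FibreCoords n N (ConnBundle n N) (Christoffel n) where
  proj := ConnBundle.pt
  coord := fun φ Γ => Γ.val.coord φ
  range := Set.univ
  isOpen_range := isOpen_univ
  nonempty_range := Set.univ_nonempty
  coord_mem := fun _ _ _ _ => Set.mem_univ _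
  exists_coord := by
    intro φ hφ x hx A _
    obtain ⟨Γ, hΓ⟩ := ConnAt.exists_coord hφ hx A
    exact ⟨⟨x, Γ⟩, rfl, hΓ⟩
  coord_inj := by
    rintro φ hφ ⟨x, Γ⟩ ⟨x', Γ'⟩ hx h h'
    change x = x' at h
    subst h
    exact congrArg (ConnBundle.mk x) (ConnAt.coord_injective hφ hx h')
  exists_trans := by
    intro φ hφ ψ hψ
    let M : Rn n → (Rn n →L[ℝ] Rn n) := fun a => fderiv ℝ (ψ.symm ≫ₕ φ) ((φ.symm ≫ₕ ψ) a)
    have hM : ContDiffOn ℝ ∞ M (φ.symm ≫ₕ ψ).source :=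
      (contDiffOn_fderiv_trans hψ hφ).comp (contDiffOn_trans hφ hψ)
        fun a ha => (φ.symm ≫ₕ ψ).map_source ha
    have hθ := contDiffOn_fderiv_trans hφ hψ
    have hθ' : ContDiffOn ℝ ∞ (fderiv ℝ (fderiv ℝ (φ.symm ≫ₕ ψ))) (φ.symm ≫ₕ ψ).source :=
      hθ.fderiv_of_isOpen (φ.symm ≫ₕ ψ).open_source (by simp)
    refine ⟨fun z => (rightComp (M z.1)).comp
      ((leftComp (fderiv ℝ (φ.symm ≫ₕ ψ) z.1)).comp (z.2.comp (M z.1))) -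
      (rightComp (M z.1)).comp ((fderiv ℝ (fderiv ℝ (φ.symm ≫ₕ ψ)) z.1).comp (M z.1)), ?_, ?_⟩
    · have m1 : MapsTo Prod.fst ((φ.symm ≫ₕ ψ).source ×ˢ (Set.univ : Set (Christoffel n)))
        (φ.symm ≫ₕ ψ).source := fun z hz => hz.1
      have c1 := hM.comp contDiff_fst.contDiffOn m1
      have c2 := hθ.comp contDiff_fst.contDiffOn m1
      have c3 := hθ'.comp contDiff_fst.contDiffOn m1
      have c4 := contDiff_rightComp.comp_contDiffOn c1
      have c5 := contDiff_leftComp.comp_contDiffOn c2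
      exact (c4.clm_comp (c5.clm_comp (contDiff_snd.contDiffOn.clm_comp c1))).sub
        (c4.clm_comp (c3.clm_comp c1))
    · rintro ⟨x, Γ⟩ hx hx'
      refine Γ.coord_trans hφ hψ hx hx' fun v => ?_
      have h3 : (φ.symm ≫ₕ ψ) (φ x) = ψ x := congrArg ψ (φ.left_inv hx)
      change _ = coordFrame φ x (fderiv ℝ (ψ.symm ≫ₕ φ) ((φ.symm ≫ₕ ψ) (φ x)) v)
      rw [h3, ← coordFrame_trans hψ hφ hx' hx, ContinuousLinearEquiv.apply_symm_apply]

instance ConnBundle.topology : TopologicalSpace (ConnBundle n N) := (connCoords n N).topology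

instance ConnBundle.chartedSpace : ChartedSpace (Rn n × Christoffel n) (ConnBundle n N) :=
  (connCoords n N).chartedSpace

instance ConnBundle.isManifold : IsManifold 𝓘(ℝ, Rn n × Christoffel n) ∞ (ConnBundle n N) :=
  (connCoords n N).isManifold

end Connections

section FibredProduct

/-- The fibred product `M ×_N C` of the bundle of metrics and the bundle of linear connections. -/
@[ext] structure MCBundle (n : ℕ) (N : Type*) [TopologicalSpace N] [ChartedSpace (Rn n) N]
    [IsManifold (𝓡 n) ∞ N] (nplus : ℕ) where
  pt : N
  met : MetricAt n nplus pt
  conn : ConnAt n pt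

/-- The space of the coordinates `(y_jk, A^i_jk)`. -/
def MCFibre (n : ℕ) : Type := SymMat n × Christoffel n

instance (n : ℕ) : NormedAddCommGroup (MCFibre n) :=
  inferInstanceAs (NormedAddCommGroup (SymMat n × Christoffel n))

instance (n : ℕ) : NormedSpace ℝ (MCFibre n) :=
  inferInstanceAs (NormedSpace ℝ (SymMat n × Christoffel n))

/-- The projection `(y_jk, A^i_jk) ↦ (y_jk)`. -/
def mcFst (n : ℕ) : MCFibre n →L[ℝ] SymMat n where
  toFun := fun z => z.1
  map_add' := fun _ _ => rfl
  map_smul' := fun _ _ => rfl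
  cont := continuous_fst (X := SymMat n) (Y := Christoffel n)

/-- The projection `(y_jk, A^i_jk) ↦ (A^i_jk)`. -/
def mcSnd (n : ℕ) : MCFibre n →L[ℝ] Christoffel n where
  toFun := fun z => z.2
  map_add' := fun _ _ => rfl
  map_smul' := fun _ _ => rfl
  cont := continuous_snd (X := SymMat n) (Y := Christoffel n)

/-- The inclusion `(y_jk) ↦ (y_jk, 0)`. -/
def mcInl (n : ℕ) : SymMat n →L[ℝ] MCFibre n where
  toFun := fun y => (y, 0)
  map_add' := fun _ _ => Prod.ext rfl (ContinuousLinearMap.ext fun _ =>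
    ContinuousLinearMap.ext fun _ => (add_zero (0 : Rn n)).symm)
  map_smul' := fun c _ => Prod.ext rfl (ContinuousLinearMap.ext fun _ =>
    ContinuousLinearMap.ext fun _ => (smul_zero (A := Rn n) c).symm)
  cont := Continuous.prodMk_left (X := SymMat n) (Y := Christoffel n) 0

variable (n : ℕ) (N : Type*) [TopologicalSpace N] [ChartedSpace (Rn n) N]
  [IsManifold (𝓡 n) ∞ N] (nplus : ℕ)

/-- The coordinate systems `(xⁱ, y_jk, A^i_jk)` of `M ×_N C`. -/
def mcCoords : FibreCoords n N (MCBundle n N nplus) (MCFibre n) where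
  proj := MCBundle.pt
  coord := fun φ e => (MetBundle.coord φ ⟨e.pt, e.met⟩, e.conn.coord φ)
  range := (sigSet n nplus ×ˢ Set.univ : Set (SymMat n × Christoffel n))
  isOpen_range := (isOpen_sigSet n nplus).prod isOpen_univ
  nonempty_range := (nonempty_sigSet n nplus).prod Set.univ_nonempty
  coord_mem := fun φ hφ e he =>
    ⟨(metricCoords n N nplus).coord_mem φ hφ ⟨e.pt, e.met⟩ he, Set.mem_univ _⟩
  exists_coord := by
    rintro φ hφ x hx ⟨y, A⟩ ⟨hy, -⟩
    obtain ⟨⟨x', g⟩, hg, hg'⟩ := (metricCoords n N nplus).exists_coord φ hφ x hx y hy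
    change x' = x at hg
    subst hg
    obtain ⟨Γ, hΓ⟩ := ConnAt.exists_coord hφ hx A
    exact ⟨⟨x', g, Γ⟩, rfl, Prod.ext hg' hΓ⟩
  coord_inj := by
    rintro φ hφ ⟨x, g, Γ⟩ ⟨x', g', Γ'⟩ hx h h'
    change x = x' at h
    subst h
    have h1 := (metricCoords n N nplus).coord_inj φ hφ ⟨x, g⟩ ⟨x, g'⟩ hx rfl
      (congrArg Prod.fst h')
    have h2 := ConnAt.coord_injective hφ hx (congrArg Prod.snd h')
    cases h1
    cases h2
    rfl
  exists_trans := by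
    intro φ hφ ψ hψ
    obtain ⟨T, hT, hT'⟩ := (metricCoords n N nplus).exists_trans φ hφ ψ hψ
    obtain ⟨S, hS, hS'⟩ := (connCoords n N).exists_trans φ hφ ψ hψ
    refine ⟨fun z => (T (z.1, z.2.1), S (z.1, z.2.2)), ?_, ?_⟩
    · have h1 := hT.comp (contDiff_fst.prodMk ((mcFst n).contDiff.comp contDiff_snd)).contDiffOn
        fun (z : Rn n × MCFibre n) (hz : z ∈ (φ.symm ≫ₕ ψ).source ×ˢ
          (sigSet n nplus ×ˢ (Set.univ : Set (Christoffel n)) : Set (MCFibre n))) =>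
          (⟨hz.1, hz.2.1⟩ : (z.1, mcFst n z.2) ∈ (φ.symm ≫ₕ ψ).source ×ˢ sigSet n nplus)
      have h2 := hS.comp (contDiff_fst.prodMk ((mcSnd n).contDiff.comp contDiff_snd)).contDiffOn
        fun (z : Rn n × MCFibre n) (hz : z ∈ (φ.symm ≫ₕ ψ).source ×ˢ
          (sigSet n nplus ×ˢ (Set.univ : Set (Christoffel n)) : Set (MCFibre n))) =>
          (⟨hz.1, hz.2.2⟩ : (z.1, mcSnd n z.2) ∈ (φ.symm ≫ₕ ψ).source ×ˢ Set.univ)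
      exact h1.prodMk h2
    · rintro ⟨x, g, Γ⟩ hx hx'
      exact Prod.ext (hT' ⟨x, g⟩ hx hx') (hS' ⟨x, Γ⟩ hx hx')

instance MCBundle.topology : TopologicalSpace (MCBundle n N nplus) := (mcCoords n N nplus).topology

instance MCBundle.chartedSpace :
    ChartedSpace (Rn n × MCFibre n) (MCBundle n N nplus) :=
  (mcCoords n N nplus).chartedSpace

instance MCBundle.isManifold :
    IsManifold 𝓘(ℝ, Rn n × MCFibre n) ∞ (MCBundle n N nplus) :=
  (mcCoords n N nplus).isManifold

end FibredProduct

section Ehresmann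

/-- The model with corners of the bundle of metrics. -/
abbrev metI (n : ℕ) := 𝓘(ℝ, Rn n × SymMat n)

/-- The model with corners of `M ×_N C`. -/
abbrev mcI (n : ℕ) := 𝓘(ℝ, Rn n × MCFibre n)

variable {n : ℕ} {N : Type*} [TopologicalSpace N] [ChartedSpace (Rn n) N]
  [IsManifold (𝓡 n) ∞ N] {nplus : ℕ}

/-- The projection `pr₁ : M ×_N C → M`. -/
def prMet (e : MCBundle n N nplus) : MetBundle n N nplus := ⟨e.pt, e.met⟩

/-- The coordinate system `(xⁱ, y_jk)` of the bundle of metrics. -/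
def metChart {φ : OpenPartialHomeomorph N (Rn n)} (hφ : φ ∈ CoordSys n N) :
    OpenPartialHomeomorph (MetBundle n N nplus) (Rn n × SymMat n) :=
  (metricCoords n N nplus).homeo φ hφ

/-- The coordinate system `(xⁱ, y_jk, A^i_jk)` of `M ×_N C`. -/
def mcChart {φ : OpenPartialHomeomorph N (Rn n)} (hφ : φ ∈ CoordSys n N) :
    OpenPartialHomeomorph (MCBundle n N nplus) (Rn n × MCFibre n) :=
  (mcCoords n N nplus).homeo φ hφ

theorem metChart_mem {φ : OpenPartialHomeomorph N (Rn n)} (hφ : φ ∈ CoordSys n N) :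
    metChart (nplus := nplus) hφ ∈ IsManifold.maximalAtlas (metI n) ∞ (MetBundle n N nplus) :=
  IsManifold.subset_maximalAtlas ((metricCoords n N nplus).homeo_mem_atlas φ hφ)

theorem mcChart_mem {φ : OpenPartialHomeomorph N (Rn n)} (hφ : φ ∈ CoordSys n N) :
    mcChart (nplus := nplus) hφ ∈ IsManifold.maximalAtlas (mcI n) ∞ (MCBundle n N nplus) :=
  IsManifold.subset_maximalAtlas ((mcCoords n N nplus).homeo_mem_atlas φ hφ)

/-- The differential of the coordinate system `(xⁱ, y_jk)` of the bundle of metrics. -/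
def metVelIso {φ : OpenPartialHomeomorph N (Rn n)} (hφ : φ ∈ CoordSys n N)
    (g : MetBundle n N nplus) (hg : g.pt ∈ φ.source) :
    TangentSpace (metI n) g ≃L[ℝ] Rn n × SymMat n :=
  (mdifferentiable_of_mem_maximalAtlas (metChart_mem hφ)).mfderiv hg

/-- The differential of the coordinate system `(xⁱ, y_jk, A^i_jk)` of `M ×_N C`. -/
def mcVelIso {φ : OpenPartialHomeomorph N (Rn n)} (hφ : φ ∈ CoordSys n N)
    (e : MCBundle n N nplus) (he : e.pt ∈ φ.source) :
    TangentSpace (mcI n) e ≃L[ℝ] Rn n × MCFibre n :=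
  (mdifferentiable_of_mem_maximalAtlas (mcChart_mem hφ)).mfderiv he

variable (n N nplus) in
/-- An Ehresmann connection on `p : M ×_N C → N`: a smooth differential 1-form `γ` on `M ×_N C` with
values in the vertical bundle `V(p) = ker p_*` such that `γ(X) = X` for every `X ∈ V(p)`. -/
structure EhresmannConnection where
  toFun : ∀ e : MCBundle n N nplus, TangentSpace (mcI n) e →L[ℝ] TangentSpace (mcI n) e
  smooth : ContMDiff (mcI n).tangent (mcI n).tangent ∞
    (fun v : TangentBundle (mcI n) (MCBundle n N nplus) =>
      (⟨v.proj, toFun v.proj v.snd⟩ : TangentBundle (mcI n) (MCBundle n N nplus)))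
  vertical : ∀ e X, mfderiv (mcI n) (𝓡 n) MCBundle.pt e (toFun e X) = 0
  apply_vertical : ∀ e X, mfderiv (mcI n) (𝓡 n) MCBundle.pt e X = 0 → toFun e X = X

theorem mcVelIso_fst {φ : OpenPartialHomeomorph N (Rn n)} (hφ : φ ∈ CoordSys n N)
    (e : MCBundle n N nplus) (he : e.pt ∈ φ.source) (X : TangentSpace (mcI n) e) :
    (mcVelIso hφ e he X).1 =
      (coordFrame φ e.pt).symm (mfderiv (mcI n) (𝓡 n) MCBundle.pt e X) := by
  have := (mfderiv_in_coord (mcChart_mem hφ) hφ (f := MCBundle.pt) (F := Prod.fst) (p := e)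
    he (fun p' hp' => hp') (fun p' hp' => rfl) differentiableAt_fst).2 X
  rw [fderiv_fst] at this
  rw [coordFrame_symm_apply hφ he]
  exact this.symm

theorem metVelIso_prMet {φ : OpenPartialHomeomorph N (Rn n)} (hφ : φ ∈ CoordSys n N)
    (e : MCBundle n N nplus) (he : e.pt ∈ φ.source) (X : TangentSpace (mcI n) e) :
    metVelIso hφ (prMet e) he (mfderiv (mcI n) (metI n) prMet e X) =
      ((mcVelIso hφ e he X).1, (mcVelIso hφ e he X).2.1) := by
  have hF : HasFDerivAt (fun z : Rn n × MCFibre n => (z.1, mcFst n z.2)) _ (mcChart hφ e) :=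
    (hasFDerivAt_fst (𝕜 := ℝ)).prodMk
      ((mcFst n).hasFDerivAt.comp (mcChart hφ e) (hasFDerivAt_snd (𝕜 := ℝ)))
  have := (mfderiv_in_coord (mcChart_mem hφ) (metChart_mem hφ) (f := prMet) (p := e) he
    (fun p' hp' => hp') (fun p' hp' => rfl) hF.differentiableAt).2 X
  rw [hF.fderiv] at this
  exact this

/-- There is exactly one homomorphism `γ_M` from `pr₁^* TM` to `pr₁^* TM` such that
`pr₁_* (γ(X)) = γ_M(pr₁_* X)` for all `X ∈ T(M ×_N C)`. -/
theorem existsUnique_gammaM (γ : EhresmannConnection n N nplus) (e : MCBundle n N nplus) :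
    ∃! γM : TangentSpace (metI n) (prMet e) →L[ℝ] TangentSpace (metI n) (prMet e),
      ∀ X : TangentSpace (mcI n) e,
        mfderiv (mcI n) (metI n) prMet e (γ.toFun e X) =
          γM (mfderiv (mcI n) (metI n) prMet e X) := by
  have hφ : chartAt (Rn n) e.pt ∈ CoordSys n N := IsManifold.chart_mem_maximalAtlas _
  have he : e.pt ∈ (chartAt (Rn n) e.pt).source := mem_chart_source _ _
  have hpr := metVelIso_prMet hφ e he
  let J : Rn n × SymMat n →L[ℝ] Rn n × MCFibre n :=
    (ContinuousLinearMap.fst ℝ _ _).prod ((mcInl n).comp (ContinuousLinearMap.snd ℝ _ _))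
  let s : TangentSpace (metI n) (prMet e) →L[ℝ] TangentSpace (mcI n) e :=
    ((mcVelIso hφ e he).symm : Rn n × MCFibre n →L[ℝ] TangentSpace (mcI n) e).comp
      (J.comp (metVelIso hφ (prMet e) he :
        TangentSpace (metI n) (prMet e) →L[ℝ] Rn n × SymMat n))
  have hs' : ∀ Y, mcVelIso hφ e he (s Y) = J (metVelIso hφ (prMet e) he Y) :=
    fun Y => (mcVelIso hφ e he).apply_symm_apply _
  have hs : ∀ Y, mfderiv (mcI n) (metI n) prMet e (s Y) = Y := by
    intro Y
    apply (metVelIso hφ (prMet e) he).injective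
    rw [hpr, hs']
    rfl
  refine ⟨(mfderiv (mcI n) (metI n) prMet e).comp ((γ.toFun e).comp s), ?_, ?_⟩
  · intro X
    let Z := X - s (mfderiv (mcI n) (metI n) prMet e X)
    have hZ0 : mfderiv (mcI n) (metI n) prMet e Z = 0 := by
      change mfderiv (mcI n) (metI n) prMet e (X - s (mfderiv (mcI n) (metI n) prMet e X)) = 0
      rw [map_sub, hs, sub_self]
    have hZ1 : mfderiv (mcI n) (𝓡 n) MCBundle.pt e Z = 0 := by
      apply (coordFrame (chartAt (Rn n) e.pt) e.pt).symm.injective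
      rw [← mcVelIso_fst hφ e he, map_zero]
      have := hpr Z
      rw [hZ0, map_zero] at this
      exact (congrArg Prod.fst this).symm
    have hZ2 := γ.apply_vertical e Z hZ1
    have hX : X = s (mfderiv (mcI n) (metI n) prMet e X) + Z := by
      simp [Z]
    change _ = mfderiv (mcI n) (metI n) prMet e
      (γ.toFun e (s (mfderiv (mcI n) (metI n) prMet e X)))
    conv_lhs => rw [hX, map_add, hZ2, map_add, hZ0, add_zero]
  · intro γM h
    ext1 Y
    change γM Y = mfderiv (mcI n) (metI n) prMet e (γ.toFun e (s Y))
    rw [h, hs]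

/-- The homomorphism `γ_M` from `pr₁^* TM` to `pr₁^* V(p_M)` determined by
`pr₁_* (γ(X)) = γ_M(pr₁_* X)` for all `X ∈ T(M ×_N C)`. -/
def gammaM (γ : EhresmannConnection n N nplus) (e : MCBundle n N nplus) :
    TangentSpace (metI n) (prMet e) →L[ℝ] TangentSpace (metI n) (prMet e) :=
  (existsUnique_gammaM γ e).choose

/-- The projection `q : F(N) → M` that sends a linear frame to the metric for which it is
orthonormal. -/
def frameProj (nplus : ℕ) (u : FrameBundle n N) : MetBundle n N nplus :=
  ⟨u.pt, frameMetric nplus u.iso⟩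

/-- The vector `q_*(X_u^h) ∈ T_g M`, where `X_u^h` is the horizontal lift to a linear frame `u` with
`q(u) = g` of the tangent vector `X` with respect to the linear connection `Γ`. -/
def projLift {x : N} (Γ : ConnAt n x) {g : MetricAt n nplus x}
    (u : Rn n ≃L[ℝ] TangentSpace (𝓡 n) x) (hu : frameMetric nplus u = g)
    (X : TangentSpace (𝓡 n) x) : TangentSpace (metI n) (⟨x, g⟩ : MetBundle n N nplus) :=
  hu ▸ (mfderiv (frameI n) (metI n) (frameProj nplus) (⟨x, u⟩ : FrameBundle n N) (Γ.lift u X) :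
    TangentSpace (metI n) (⟨x, frameMetric nplus u⟩ : MetBundle n N nplus))

/-- The condition `(C_M)`: for every metric `g` and every linear connection `Γ` at a point, every
`X ∈ T_g M` and every linear frame `u ∈ q⁻¹(g)`,
`γ_M((g, Γ), X) = X - q_*((p_M_* X)_u^h)`. -/
def ConditionCM (γ : EhresmannConnection n N nplus) : Prop :=
  ∀ (x : N) (g : MetricAt n nplus x) (Γ : ConnAt n x)
    (X : TangentSpace (metI n) (⟨x, g⟩ : MetBundle n N nplus))
    (u : Rn n ≃L[ℝ] TangentSpace (𝓡 n) x) (hu : frameMetric nplus u = g),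
    gammaM γ ⟨x, g, Γ⟩ X =
      X - projLift Γ u hu (mfderiv (metI n) (𝓡 n) MetBundle.pt ⟨x, g⟩ X)

/-- The coordinate function `xⁱ` on `M ×_N C`. -/
def xCoord (φ : OpenPartialHomeomorph N (Rn n)) (i : Fin n) (e : MCBundle n N nplus) : ℝ :=
  φ e.pt i

/-- The coordinate function `y_jk` on `M ×_N C`. -/
def yCoord (φ : OpenPartialHomeomorph N (Rn n)) (j k : Fin n) (e : MCBundle n N nplus) : ℝ :=
  e.met.form (coordFrame φ e.pt (stdVec n j)) (coordFrame φ e.pt (stdVec n k))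

/-- The coordinate function `A^i_jk` on `M ×_N C`. -/
def aCoord (φ : OpenPartialHomeomorph N (Rn n)) (i j k : Fin n) (e : MCBundle n N nplus) : ℝ :=
  e.conn.coord φ (stdVec n j) (stdVec n k) i

/-- The differential `dxⁱ` on `M ×_N C`. -/
def dxCoord (φ : OpenPartialHomeomorph N (Rn n)) (i : Fin n) (e : MCBundle n N nplus) :
    TangentSpace (mcI n) e →L[ℝ] ℝ :=
  mfderiv (mcI n) 𝓘(ℝ, ℝ) (xCoord φ i) e

/-- The differential `dy_jk` on `M ×_N C`. -/
def dyCoord (φ : OpenPartialHomeomorph N (Rn n)) (j k : Fin n) (e : MCBundle n N nplus) :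
    TangentSpace (mcI n) e →L[ℝ] ℝ :=
  mfderiv (mcI n) 𝓘(ℝ, ℝ) (yCoord φ j k) e

/-- The coordinate vector `∂/∂x^j` of the coordinate system `(xⁱ, y_jk, A^i_jk)` of `M ×_N C`. -/
def coordVec {φ : OpenPartialHomeomorph N (Rn n)} (hφ : φ ∈ CoordSys n N) (j : Fin n)
    (e : MCBundle n N nplus) (he : e.pt ∈ φ.source) : TangentSpace (mcI n) e :=
  (mcVelIso hφ e he).symm (stdVec n j, 0)

/-- The coefficient `γ_klj` of an Ehresmann connection, i.e. the value of `dy_kl ∘ γ` at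
`∂/∂x^j`. -/
def gammaCoeff (γ : EhresmannConnection n N nplus) {φ : OpenPartialHomeomorph N (Rn n)}
    (hφ : φ ∈ CoordSys n N) (k l j : Fin n) (e : MCBundle n N nplus) (he : e.pt ∈ φ.source) : ℝ :=
  dyCoord φ k l e (γ.toFun e (coordVec hφ j e he))

theorem dxCoord_apply {φ : OpenPartialHomeomorph N (Rn n)} (hφ : φ ∈ CoordSys n N)
    (i : Fin n) (e : MCBundle n N nplus) (he : e.pt ∈ φ.source) (X : TangentSpace (mcI n) e) :
    dxCoord φ i e X = (mcVelIso hφ e he X).1 i := by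
  have hF := ((EuclideanSpace.proj (𝕜 := ℝ) i).hasFDerivAt).comp (mcChart hφ e)
    (hasFDerivAt_fst (𝕜 := ℝ) (p := mcChart hφ e))
  have := (mfderiv_fun_in_coord (mcChart_mem hφ) (f := xCoord φ i)
    (p := e) he (fun p' hp' => rfl) hF.differentiableAt).2 X
  rw [hF.fderiv] at this
  exact this

theorem dyCoord_apply {φ : OpenPartialHomeomorph N (Rn n)} (hφ : φ ∈ CoordSys n N)
    (k l : Fin n) (e : MCBundle n N nplus) (he : e.pt ∈ φ.source) (X : TangentSpace (mcI n) e) :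
    dyCoord φ k l e X = (mcVelIso hφ e he X).2.1.1 k l := by
  let G : SymMat n →L[ℝ] ℝ :=
    ((ContinuousLinearMap.proj l).comp (ContinuousLinearMap.proj (R := ℝ) k)).comp
      (SymMat n).subtypeL
  have hF : HasFDerivAt (fun z : Rn n × MCFibre n => (G.comp (mcFst n)) z.2) _ (mcChart hφ e) :=
    (G.comp (mcFst n)).hasFDerivAt.comp (mcChart hφ e) (hasFDerivAt_snd (𝕜 := ℝ))
  have := (mfderiv_fun_in_coord (mcChart_mem hφ) (f := yCoord φ k l)
    (p := e) he (fun p' hp' => rfl) hF.differentiableAt).2 X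
  rw [hF.fderiv] at this
  exact this

theorem vertical_decomposition {T V : Type*} [AddCommGroup T] [Module ℝ T] [AddCommGroup V]
    [Module ℝ V] (L : T ≃ₗ[ℝ] Rn n × V) (g : T →ₗ[ℝ] T) (hg : ∀ Z, (L Z).1 = 0 → g Z = Z)
    (d : T →ₗ[ℝ] ℝ) (hd : ∀ j, d (L.symm (stdVec n j, 0)) = 0) (X : T) :
    d (g X) = d X + ∑ j, d (g (L.symm (stdVec n j, 0))) * (L X).1 j := by
  let c : Fin n → T := fun j => L.symm (stdVec n j, 0)
  let Z := X - ∑ j, (L X).1 j • c j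
  have hc : ∀ j, (L (c j)).1 = stdVec n j := fun j =>
    congrArg Prod.fst (L.apply_symm_apply (stdVec n j, 0))
  have hZ : (L Z).1 = 0 := by
    simp only [Z, map_sub, map_sum, map_smul, Prod.fst_sub, Prod.fst_sum, Prod.smul_fst, hc]
    exact sub_eq_zero.2 (sum_stdVec n _).symm
  have hX : X = Z + ∑ j, (L X).1 j • c j := by simp [Z]
  have hd' : d X = d Z := by
    conv_lhs => rw [hX, map_add, map_sum]
    simp [c, hd]
  have hgX : g X = Z + ∑ j, (L X).1 j • g (c j) := by
    conv_lhs => rw [hX, map_add, hg Z hZ, map_sum]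
    simp
  rw [hd', hgX, map_add, map_sum]
  simp [c, mul_comm]

/-- The local expression of an Ehresmann connection: the component of `γ` along `∂/∂y_kl` is
`dy_kl + γ_klj dx^j`. -/
theorem gamma_local_expression (γ : EhresmannConnection n N nplus)
    {φ : OpenPartialHomeomorph N (Rn n)} (hφ : φ ∈ CoordSys n N) (k l : Fin n)
    (e : MCBundle n N nplus) (he : e.pt ∈ φ.source) (X : TangentSpace (mcI n) e) :
    dyCoord φ k l e (γ.toFun e X) = dyCoord φ k l e X +
      ∑ j, gammaCoeff γ hφ k l j e he * dxCoord φ j e X := by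
  have h := vertical_decomposition (mcVelIso hφ e he).toLinearEquiv (γ.toFun e).toLinearMap
    (fun Z hZ => γ.apply_vertical e Z (by
      apply (coordFrame φ e.pt).symm.injective
      rw [← mcVelIso_fst hφ e he, map_zero]
      exact hZ)) (dyCoord φ k l e).toLinearMap (fun j => by
      have h1 := dyCoord_apply hφ k l e he (coordVec hφ j e he)
      have h2 : mcVelIso hφ e he (coordVec hφ j e he) = (stdVec n j, 0) :=
        (mcVelIso hφ e he).apply_symm_apply _
      rw [h2] at h1
      exact h1) X
  refine h.trans ?_
  refine congrArg₂ (· + ·) rfl (Finset.sum_congr rfl fun j _ => ?_)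
  rw [dxCoord_apply hφ j e he]
  rfl

end Ehresmann

end MetConn

end

open scoped Manifold ContDiff
open MetConn

open Set Filter Topology

namespace MetConn

noncomputable section


/-! Both claims come from computing the components of $q_*(X_u^h)$ in the coordinates
$(x^i,y_{jk})$.

If the frame $u$ has coordinate matrix $L$, then its dual coframe has matrix $L^{-1}$, so $q$ is
given locally by $L\mapsto B(L^{-1},L^{-1})$, where $B$ is the symmetrized bilinear form with signs
$\varepsilon_h$. The horizontal lift of $X$ at $u$ has components $(v,-A_vL)$, where $v$ is the
coordinate vector of $X$ and $A_v$ is the matrix $(A^i_{jk}v^j)$. Inversion has derivative $H\mapsto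
-L^{-1}HL^{-1}$, which sends $-A_vL$ to $L^{-1}A_v$: the factor $L$ cancels on the right. By the
Leibniz rule the $y_{kl}$-component of $q_*(X_u^h)$ is
$g(A_v\partial_k,\partial_l)+g(A_v\partial_l,\partial_k)$. The remaining factors $L^{-1}$ have been
absorbed into $g$, so the vector does not depend on the choice of $u$ over $g$. This is
`metVelIso_projLift`, and the first claim is `projLift_eq_of_frameMetric_eq`.

For the second claim, `metVelIso_gammaM` gives the components of $\gamma_M(Y)$: zero along the base
and $dy_{kl}(Y)+\gamma_{klj}v^j$ along the fibre, where now $v$ is the base part of $Y$. In $(C_M)$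
the base components agree automatically, since $q_*(X_u^h)$ projects to $X$, and the term
$dy_{kl}(Y)$ cancels. What is left is an equality of two linear forms in $v$
(`gammaM_eq_sub_projLift_iff`). Comparing their coefficients gives the formula for $\gamma_{klj}$.
-/

/-! ### The map $q$ in coordinates and its derivative. -/

/-- The local expression of `q : F(N) → M`: the matrix of the metric of the frame with matrix `L`
is `∑_h ε_h (L⁻¹)^h_j (L⁻¹)^h_k`. -/
def localFrameProj (n r : ℕ) (z : Rn n × (Rn n →L[ℝ] Rn n)) : Rn n × SymMat n :=
  (z.1, epsBilin n r (Ring.inverse z.2) (Ring.inverse z.2))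

/-- The inverse of the frame matrix is the matrix of the dual coframe evaluated on the coordinate
vectors. This ties the `Ring.inverse` of `localFrameProj`, a total function to which differential
calculus applies at units, to the map `u.symm` that defines `frameMetric`. -/
theorem inverse_coord {n : ℕ} {N : Type*} [TopologicalSpace N] [ChartedSpace (Rn n) N]
    (φ : OpenPartialHomeomorph N (Rn n)) (u : FrameBundle n N) :
    Ring.inverse (FrameBundle.coord φ u) =
      ((coordFrame φ u.pt).trans u.iso.symm : Rn n ≃L[ℝ] Rn n) :=
  Ring.inverse_unit (ContinuousLinearEquiv.toUnit (u.iso.trans (coordFrame φ u.pt).symm))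

/-- The cancellation behind the independence of the frame: `U` is the matrix of the frame, and `-(A
* U)` is the vertical part of the horizontal lift at that frame. -/
theorem inv_mul_neg_mul_mul_inv {R : Type*} [Ring R] (U : Rˣ) (A : R) :
    ↑U⁻¹ * -(A * ↑U) * ↑U⁻¹ = -(↑U⁻¹ * A) := by
  simp [mul_assoc]

/-- The derivative of inversion, $H\mapsto -L^{-1}HL^{-1}$, combined with the Leibniz rule for
`epsBilin`. Only the values of the derivative are needed later, so it is kept abstract as `D`. -/
theorem hasFDerivAt_localFrameProj (r : ℕ) (a : Rn n) (L : (Rn n →L[ℝ] Rn n)ˣ) :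
    ∃ D : (Rn n × (Rn n →L[ℝ] Rn n)) →L[ℝ] Rn n × SymMat n,
      HasFDerivAt (localFrameProj n r) D (a, (L : Rn n →L[ℝ] Rn n)) ∧
      ∀ v H, D (v, H) = (v, -(epsBilin n r (↑L⁻¹ : Rn n →L[ℝ] Rn n) (↑L⁻¹ * H * ↑L⁻¹) +
        epsBilin n r (↑L⁻¹ * H * ↑L⁻¹) (↑L⁻¹ : Rn n →L[ℝ] Rn n))) := by
  have h1 : HasFDerivAt (fun z : Rn n × (Rn n →L[ℝ] Rn n) => Ring.inverse z.2) _
      (a, (L : Rn n →L[ℝ] Rn n)) :=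
    HasFDerivAt.comp (f := Prod.snd) (g := Ring.inverse) (a, (L : Rn n →L[ℝ] Rn n)) (hasFDerivAt_ringInverse (𝕜 := ℝ) L)
      (hasFDerivAt_snd (𝕜 := ℝ))
  have h2 := (hasFDerivAt_fst (𝕜 := ℝ) (p := (a, (L : Rn n →L[ℝ] Rn n)))).prodMk
    ((epsBilin n r).hasFDerivAt_of_bilinear h1 h1)
  refine ⟨_, h2, fun v H => Prod.ext rfl ?_⟩
  change epsBilin n r (Ring.inverse (L : Rn n →L[ℝ] Rn n)) (-(↑L⁻¹ * H * ↑L⁻¹)) +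
    epsBilin n r (-(↑L⁻¹ * H * ↑L⁻¹)) (Ring.inverse (L : Rn n →L[ℝ] Rn n)) = _
  -- At the base point the matrix is a unit, so `Ring.inverse` is the true inverse; the minus sign
  -- then comes out of each argument of the bilinear form.
  rw [Ring.inverse_unit, map_neg, map_neg, neg_add]
  rfl

variable {n : ℕ} {N : Type*} [TopologicalSpace N] [ChartedSpace (Rn n) N]
  [IsManifold (𝓡 n) ∞ N] {nplus : ℕ}

/-- No condition on the base point is needed: `coordFrame` is an isomorphism everywhere, with an
arbitrary value off the domain, and both sides are built from the same one. -/
theorem metChart_frameProj {φ : OpenPartialHomeomorph N (Rn n)} (hφ : φ ∈ CoordSys n N)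
    (u : FrameBundle n N) :
    metChart hφ (frameProj nplus u) = localFrameProj n nplus (frameChart hφ u) := by
  refine Prod.ext rfl ?_
  change _ = epsBilin n nplus (Ring.inverse (FrameBundle.coord φ u))
    (Ring.inverse (FrameBundle.coord φ u))
  rw [inverse_coord]
  ext j k
  rw [epsBilin_self_apply]
  rfl

/-! ### The projection to $M$ of a horizontal lift. -/

/-- The components of `q_*(X_u^h)` in the coordinate system `(xⁱ, y_jk)`. -/
theorem metVelIso_projLift {φ : OpenPartialHomeomorph N (Rn n)} (hφ : φ ∈ CoordSys n N) {x : N}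
    (hx : x ∈ φ.source) (Γ : ConnAt n x) {g : MetricAt n nplus x}
    (u : Rn n ≃L[ℝ] TangentSpace (𝓡 n) x) (hu : frameMetric nplus u = g)
    (X : TangentSpace (𝓡 n) x) :
    (metVelIso hφ ⟨x, g⟩ hx (projLift Γ u hu X)).1 = (coordFrame φ x).symm X ∧
    ∀ k l, (metVelIso hφ ⟨x, g⟩ hx (projLift Γ u hu X)).2.1 k l =
      g.form (coordFrame φ x (Γ.coord φ ((coordFrame φ x).symm X) (stdVec n k)))
        (coordFrame φ x (stdVec n l)) +
      g.form (coordFrame φ x (Γ.coord φ ((coordFrame φ x).symm X) (stdVec n l)))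
        (coordFrame φ x (stdVec n k)) := by
  -- Replacing `g` by the metric of `u` makes the transport in the definition of `projLift` trivial,
  -- so that it becomes the differential of `frameProj`.
  subst hu
  -- The coordinate matrix of the frame, as a unit of the ring of endomorphisms, where the
  -- derivative of inversion is known.
  let U := ContinuousLinearEquiv.toUnit (u.trans (coordFrame φ x).symm)
  obtain ⟨D, hD, hD'⟩ := hasFDerivAt_localFrameProj nplus (φ x) U
  have h := (mfderiv_in_coord (frameChart_mem hφ) (metChart_mem hφ) (f := frameProj nplus)
    (F := localFrameProj n nplus) (p := ⟨x, u⟩) hx (fun p' hp' => hp')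
    (fun p' _ => metChart_frameProj hφ p') hD.differentiableAt).2 (Γ.lift u X)
  have h' : metVelIso hφ ⟨x, frameMetric nplus u⟩ hx (projLift Γ u rfl X) =
      D (frameVel hφ ⟨x, u⟩ (Γ.lift u X)) := by
    rw [← hD.fderiv]
    exact h
  rw [frameVel_lift hφ hx, hD'] at h'
  set A := Γ.coord φ ((coordFrame φ x).symm X) with hA
  -- Here the trailing factor of the frame disappears. With the outer sign of the derivative, the
  -- variation of the coframe matrix is `↑U⁻¹ * A`.
  have hU : (↑U⁻¹ * -(A.comp (FrameBundle.coord φ ⟨x, u⟩)) * ↑U⁻¹ : Rn n →L[ℝ] Rn n) =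
      -(↑U⁻¹ * A) := by
    exact inv_mul_neg_mul_mul_inv U A
  rw [hU] at h'
  rw [h']
  refine ⟨rfl, fun k l => ?_⟩
  rw [map_neg, map_neg, neg_apply]
  rw [frameMetric_apply, frameMetric_apply]
  change -((-(epsBilin n nplus (↑U⁻¹ : Rn n →L[ℝ] Rn n) (↑U⁻¹ * A)).1 k l) +
    (-(epsBilin n nplus (↑U⁻¹ * A) (↑U⁻¹ : Rn n →L[ℝ] Rn n)).1 k l)) = _
  rw [epsBilin_apply, epsBilin_apply]
  -- Applying the inverse matrix means taking the components, in the frame `u`, of the vector with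
  -- the given coordinates. The sums over `h` therefore become values of the metric.
  have e1 : ∀ w, (↑U⁻¹ : Rn n →L[ℝ] Rn n) w = u.symm (coordFrame φ x w) := fun w => rfl
  simp only [mul_apply_eq_comp, e1]
  -- Each `epsBilin` term is a symmetrization and contributes one half of both metric values, with
  -- the factors in opposite orders in the two terms. Commuting the factors lets the halves add up.
  have e2 : ∀ v w : Rn n, ∑ h, eps nplus h * (v h * w h) = ∑ h, eps nplus h * (w h * v h) :=
    fun v w => Finset.sum_congr rfl fun h _ => by ring
  rw [e2 (u.symm (coordFrame φ x (stdVec n k))), e2 (u.symm (coordFrame φ x (stdVec n l)))]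
  ring

/-- The components found in `metVelIso_projLift` involve `g`, `Γ` and `X` but not the frame, and one
chart around `x` is enough to compare two tangent vectors. -/
theorem projLift_eq_of_frameMetric_eq {x : N} (Γ : ConnAt n x) {g : MetricAt n nplus x}
    (u u' : Rn n ≃L[ℝ] TangentSpace (𝓡 n) x) (hu : frameMetric nplus u = g)
    (hu' : frameMetric nplus u' = g) (X : TangentSpace (𝓡 n) x) :
    projLift Γ u hu X = projLift Γ u' hu' X := by
  have hφ : chartAt (Rn n) x ∈ CoordSys n N := IsManifold.chart_mem_maximalAtlas _
  have hx := mem_chart_source (Rn n) x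
  have h := metVelIso_projLift hφ hx Γ u hu X
  have h' := metVelIso_projLift hφ hx Γ u' hu' X
  apply (metVelIso hφ ⟨x, g⟩ hx).injective
  refine Prod.ext (h.1.trans h'.1.symm) ?_
  ext k l
  rw [h.2, h'.2]

/-! ### The homomorphism $\gamma_M$ in coordinates. -/

/-- The components of `γ_M(Y)` in the coordinate system `(xⁱ, y_jk)`. -/
theorem metVelIso_gammaM (γ : EhresmannConnection n N nplus)
    {φ : OpenPartialHomeomorph N (Rn n)} (hφ : φ ∈ CoordSys n N) (e : MCBundle n N nplus)
    (he : e.pt ∈ φ.source) (Y : TangentSpace (metI n) (prMet e)) :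
    (metVelIso hφ (prMet e) he (gammaM γ e Y)).1 = 0 ∧
    ∀ k l, (metVelIso hφ (prMet e) he (gammaM γ e Y)).2.1 k l =
      (metVelIso hφ (prMet e) he Y).2.1 k l +
        ∑ j, gammaCoeff γ hφ k l j e he * (metVelIso hφ (prMet e) he Y).1 j := by
  -- A lift of `Y` along $\mathrm{pr}_1$. By the defining property of $\gamma_M$ any lift would do;
  -- this one has zero components along the $A^i_{jk}$.
  let X : TangentSpace (mcI n) e := (mcVelIso hφ e he).symm
    ((metVelIso hφ (prMet e) he Y).1, mcInl n (metVelIso hφ (prMet e) he Y).2)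
  have hX : mcVelIso hφ e he X =
      ((metVelIso hφ (prMet e) he Y).1, mcInl n (metVelIso hφ (prMet e) he Y).2) :=
    (mcVelIso hφ e he).apply_symm_apply _
  have hY : mfderiv (mcI n) (metI n) prMet e X = Y := by
    apply (metVelIso hφ (prMet e) he).injective
    rw [metVelIso_prMet hφ e he, hX]
    rfl
  have hγ : gammaM γ e Y = mfderiv (mcI n) (metI n) prMet e (γ.toFun e X) := by
    have := (existsUnique_gammaM γ e).choose_spec.1 X
    rw [hY] at this
    exact this.symm
  rw [hγ, metVelIso_prMet hφ e he]
  refine ⟨?_, fun k l => ?_⟩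
  · change (mcVelIso hφ e he (γ.toFun e X)).1 = 0
    -- The base component vanishes because $\gamma$ takes values in the vertical bundle.
    rw [mcVelIso_fst hφ e he, γ.vertical, map_zero]
  · change (mcVelIso hφ e he (γ.toFun e X)).2.1.1 k l = _
    rw [← dyCoord_apply hφ k l e he, gamma_local_expression γ hφ k l e he,
      dyCoord_apply hφ k l e he]
    simp only [dxCoord_apply hφ _ e he, hX]
    rfl

/-! ### The condition $(C_M)$ in coordinates. -/

theorem metVelIso_fst {φ : OpenPartialHomeomorph N (Rn n)} (hφ : φ ∈ CoordSys n N)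
    (g : MetBundle n N nplus) (hg : g.pt ∈ φ.source) (Y : TangentSpace (metI n) g) :
    (metVelIso hφ g hg Y).1 =
      (coordFrame φ g.pt).symm (mfderiv (metI n) (𝓡 n) MetBundle.pt g Y) := by
  have := (mfderiv_in_coord (metChart_mem hφ) hφ (f := MetBundle.pt) (F := Prod.fst) (p := g)
    hg (fun p' hp' => hp') (fun p' hp' => rfl) differentiableAt_fst).2 Y
  rw [fderiv_fst] at this
  rw [coordFrame_symm_apply hφ hg]
  exact this.symm

theorem form_coordFrame (φ : OpenPartialHomeomorph N (Rn n)) (e : MCBundle n N nplus)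
    (v : Rn n) (l : Fin n) :
    e.met.form (coordFrame φ e.pt v) (coordFrame φ e.pt (stdVec n l)) =
      ∑ a, v a * yCoord φ a l e := by
  conv_lhs => rw [← sum_stdVec n v]
  simp only [map_sum, map_smul, LinearMap.sum_apply, LinearMap.smul_apply, smul_eq_mul]
  rfl

/-- The condition `(C_M)` at a point and a tangent vector, in coordinates. -/
theorem gammaM_eq_sub_projLift_iff (γ : EhresmannConnection n N nplus)
    {φ : OpenPartialHomeomorph N (Rn n)} (hφ : φ ∈ CoordSys n N) (e : MCBundle n N nplus)
    (he : e.pt ∈ φ.source) (Y : TangentSpace (metI n) (⟨e.pt, e.met⟩ : MetBundle n N nplus))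
    (u : Rn n ≃L[ℝ] TangentSpace (𝓡 n) e.pt) (hu : frameMetric nplus u = e.met) :
    gammaM γ e Y = Y - projLift e.conn u hu (mfderiv (metI n) (𝓡 n) MetBundle.pt ⟨e.pt, e.met⟩ Y) ↔
      ∀ k l, ∑ j, gammaCoeff γ hφ k l j e he * (metVelIso hφ ⟨e.pt, e.met⟩ he Y).1 j =
        ∑ j, -(∑ a, (yCoord φ a l e * aCoord φ a j k e + yCoord φ a k e * aCoord φ a j l e)) *
          (metVelIso hφ ⟨e.pt, e.met⟩ he Y).1 j := by
  have h1 := metVelIso_gammaM γ hφ e he Y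
  have h2 := metVelIso_projLift hφ he e.conn u hu
    (mfderiv (metI n) (𝓡 n) MetBundle.pt ⟨e.pt, e.met⟩ Y)
  have h3 := metVelIso_fst hφ ⟨e.pt, e.met⟩ he Y
  change _ = (coordFrame φ e.pt).symm _ at h3
  -- The vector being lifted is $(p_M)_*Y$, so its coordinate vector is the base part `v` of `Y`.
  -- Both sides of the condition are now expressed through the same `v`.
  rw [← h3] at h2
  set v := (metVelIso hφ ⟨e.pt, e.met⟩ he Y).1 with hv
  -- Expanding the Christoffel array in its direction argument `v` and the metric in its first
  -- argument displays $g(A_v\partial_k,\partial_l)$ as a linear form in `v`.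
  have h4 : ∀ k l, e.met.form (coordFrame φ e.pt (e.conn.coord φ v (stdVec n k)))
      (coordFrame φ e.pt (stdVec n l)) = ∑ j, (∑ a, yCoord φ a l e * aCoord φ a j k e) * v j := by
    intro k l
    have hw : ∀ a, e.conn.coord φ v (stdVec n k) a = ∑ j, v j * aCoord φ a j k e := by
      intro a
      conv_lhs => rw [← sum_stdVec n v]
      simp [aCoord]
    rw [form_coordFrame]
    simp only [hw, Finset.sum_mul]
    rw [Finset.sum_comm]
    exact Finset.sum_congr rfl fun j _ => Finset.sum_congr rfl fun a _ => by ring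
  have h5 : ∀ k l, ∑ j, -(∑ a, (yCoord φ a l e * aCoord φ a j k e +
      yCoord φ a k e * aCoord φ a j l e)) * v j =
      -(metVelIso hφ ⟨e.pt, e.met⟩ he (projLift e.conn u hu
        (mfderiv (metI n) (𝓡 n) MetBundle.pt ⟨e.pt, e.met⟩ Y))).2.1 k l := by
    intro k l
    refine Eq.trans ?_ (congrArg Neg.neg (h2.2 k l)).symm
    rw [h4, h4, ← Finset.sum_add_distrib, ← Finset.sum_neg_distrib]
    refine Finset.sum_congr rfl fun j _ => ?_
    rw [Finset.sum_add_distrib]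
    ring
  -- The differential of the chart is linear and injective, so the equation in $T_gM$ is equivalent
  -- to the equation of components.
  have h6 : gammaM γ e Y =
      Y - projLift e.conn u hu (mfderiv (metI n) (𝓡 n) MetBundle.pt ⟨e.pt, e.met⟩ Y) ↔
      metVelIso hφ ⟨e.pt, e.met⟩ he (gammaM γ e Y) = metVelIso hφ ⟨e.pt, e.met⟩ he Y -
        metVelIso hφ ⟨e.pt, e.met⟩ he
          (projLift e.conn u hu (mfderiv (metI n) (𝓡 n) MetBundle.pt ⟨e.pt, e.met⟩ Y)) := by
    refine (metVelIso hφ ⟨e.pt, e.met⟩ he).injective.eq_iff.symm.trans ?_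
    exact Eq.congr_right (map_sub (metVelIso hφ ⟨e.pt, e.met⟩ he) _ _)
  rw [h6]
  simp only [h5]
  constructor
  · intro h k l
    have h7 := congrArg (fun z : Rn n × SymMat n => z.2.1 k l) h
    have h8 := (h1.2 k l).symm.trans h7
    -- The $y_{kl}$-component of `Y` occurs on both sides and cancels, so only its base part enters
    -- the condition.
    have h9 : ∀ a b c : ℝ, a + b = a - c → b = -c := fun a b c h => by linarith
    exact h9 _ _ _ h8
  · intro h
    refine Prod.ext ?_ ?_
    -- The base components agree without any assumption on the coefficients: $\gamma_M(Y)$ is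
    -- vertical, and the lifted vector has the same projection as `Y`.
    · refine h1.1.trans ?_
      change 0 = v - _
      exact (sub_eq_zero.2 h2.1.symm).symm
    · ext k l
      refine (h1.2 k l).trans ?_
      refine (congrArg (_ + ·) (h k l)).trans ?_
      exact (sub_eq_add_neg _ _).symm

/-- The pointwise criterion holds in each single chart. Hence $(C_M)$ yields the formula in every
coordinate system, while one chart around each point is enough for the converse. -/
theorem conditionCM_iff (γ : EhresmannConnection n N nplus) :
    ConditionCM γ ↔
      ∀ (φ : OpenPartialHomeomorph N (Rn n)) (hφ : φ ∈ CoordSys n N)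
        (e : MCBundle n N nplus) (he : e.pt ∈ φ.source) (k l j : Fin n),
        gammaCoeff γ hφ k l j e he =
          -∑ a, (yCoord φ a l e * aCoord φ a j k e + yCoord φ a k e * aCoord φ a j l e) := by
  constructor
  · intro h φ hφ e he k l j
    -- The condition concerns frames over `e.met`, so at least one is needed to apply it; the
    -- signature of the metric provides it.
    obtain ⟨u, hu⟩ := exists_frameMetric_eq e.met
    -- Testing on the coordinate vector $\partial/\partial x^j$ of $M$ isolates the `j`-th
    -- coefficient of the two linear forms.
    have h1 := (gammaM_eq_sub_projLift_iff γ hφ e he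
      ((metVelIso hφ ⟨e.pt, e.met⟩ he).symm (stdVec n j, 0)) u hu).1
        (h e.pt e.met e.conn _ u hu) k l
    have h2 : metVelIso hφ ⟨e.pt, e.met⟩ he ((metVelIso hφ ⟨e.pt, e.met⟩ he).symm (stdVec n j, 0)) =
      (stdVec n j, 0) := (metVelIso hφ ⟨e.pt, e.met⟩ he).apply_symm_apply _
    rw [h2] at h1
    simpa [stdVec_apply] using h1
  · intro h x g Γ X u hu
    have hφ : chartAt (Rn n) x ∈ CoordSys n N := IsManifold.chart_mem_maximalAtlas _
    refine (gammaM_eq_sub_projLift_iff γ hφ ⟨x, g, Γ⟩ (mem_chart_source _ x) X u hu).2 ?_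
    intro k l
    exact Finset.sum_congr rfl fun j _ => by rw [h _ hφ]

end

end MetConn

theorem mainTheorem6 {n : ℕ} (nplus nminus : ℕ) (_hn : nplus + nminus = n)
    (N : Type*) [TopologicalSpace N] [ChartedSpace (Rn n) N] [IsManifold (𝓡 n) ∞ N]
    (γ : EhresmannConnection n N nplus) :
    (∀ (x : N) (g : MetricAt n nplus x) (Γ : ConnAt n x) (X : TangentSpace (𝓡 n) x)
      (u u' : Rn n ≃L[ℝ] TangentSpace (𝓡 n) x)
      (hu : frameMetric nplus u = g) (hu' : frameMetric nplus u' = g),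
      projLift Γ u hu X = projLift Γ u' hu' X) ∧
    (ConditionCM γ ↔
      ∀ (φ : OpenPartialHomeomorph N (Rn n)) (hφ : φ ∈ CoordSys n N)
        (e : MCBundle n N nplus) (he : e.pt ∈ φ.source) (k l j : Fin n),
        gammaCoeff γ hφ k l j e he =
          -∑ a, (yCoord φ a l e * aCoord φ a j k e + yCoord φ a k e * aCoord φ a j l e)) := by
  exact ⟨fun x g Γ X u u' hu hu' => projLift_eq_of_frameMetric_eq Γ u u' hu hu' X, conditionCM_iff γ⟩
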